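/- Let $p\in[2,\infty)$. There is a constant $C<\infty$ depending only on $p$ such that the following holds. Let $(\Omega,\mathcal F,\mathbf P)$ be a probability space and $(\mathbb U,\mathcal U,\mu)$ a $\sigma$-finite measure space. Let $\mathbf N_\sigma$ be the set of $\sigma$-finite measures on $\mathbb U$ with values in $\{0,1,2,\dots,\infty\}$, equipped with the smallest $\sigma$-algebra $\mathcal N_\sigma$ making $\xi\mapsto\xi(W)$ measurable for every $W\in\mathcal U$. Let $\eta:\Omega\to\mathbf N_\sigma$ be a Poisson point process on $\mathbb U$ with intensity measure $\mu$. Let $F=f(\eta)$, where $f:\mathbf N_\sigma\to\mathbb R$ is $\mathcal N_\sigma$-measurable, be such that $\mathbb E|F|<\infty$, and put $$D_uF:=f(\eta+\delta_u)-f(\eta),\qquad u\in\mathbb U .$$ Then, as an inequality in $[0,\infty]$, $$\|F\|_{L^p_\omega}\le C\left(|\mathbb E F|+\|D_uF\|_{L^p_\omega L^2_u\cap L^p_\omega L^p_u}\right),$$ where $$\|G\|_{L^p_\omega L^2_u\cap L^p_\omega L^p_u}:=\max\left\{\left(\mathbb E\Big(\int_{\mathbb U}|G_u|^2\,d\mu(u)\Big)^{p/2}\right)^{1/p},\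 \left(\mathbb E\int_{\mathbb U}|G_u|^p\,d\mu(u)\right)^{1/p}\right\}.$$ Moreover, with the same constant $C$, $$\|F\|_{L^p_\omega}\le C\left(|\mathbb E F|+\|D_uF\|_{\Sigma_u^{\{2,p\}}L^p_\omega}\right),\qquad \|G\|_{\Sigma_u^{\{2,p\}}L^p_\omega}:=\sum_{q\in\{2,p\}}\left(\int_{\mathbb U}\big(\mathbb E|G_u|^p\big)^{q/p}\,d\mu(u)\right)^{1/q},$$ where the sum runs over the set $\{2,p\}$ (so it has a single term if $p=2$). -/

import Mathlib

open MeasureTheory ProbabilityTheory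
open scoped ENNReal NNReal

/-- `ξ` is a `σ`-finite measure taking values in `{0, 1, 2, …, ∞}`. -/
def IsCountingMeasure {U : Type*} [MeasurableSpace U] (ξ : Measure U) : Prop :=
  SigmaFinite ξ ∧ ∀ W : Set U, MeasurableSet W → ξ W = ∞ ∨ ∃ n : ℕ, ξ W = n

/-- The space `𝐍_σ` of `σ`-finite measures on `U` with values in `{0, 1, 2, …, ∞}`. -/
abbrev CountingMeasure (U : Type*) [MeasurableSpace U] : Type _ :=
  {ξ : Measure U // IsCountingMeasure ξ}

/-- The `σ`-algebra on `𝐍_σ` (restricted from Mathlib's `σ`-algebra on `Measure U`) is the smallest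
one that makes every evaluation `ξ ↦ ξ W`, with `W` measurable, measurable. -/
theorem CountingMeasure.measurableSpace_eq (U : Type*) [MeasurableSpace U] :
    (inferInstance : MeasurableSpace (CountingMeasure U)) =
      ⨆ (W : Set U) (_ : MeasurableSet W),
        (borel ℝ≥0∞).comap (fun ξ : CountingMeasure U => (ξ : Measure U) W) := by
  have h : (inferInstance : MeasurableSpace (CountingMeasure U)) =
      (⨆ (W : Set U) (_ : MeasurableSet W),
        (borel ℝ≥0∞).comap (fun ξ : Measure U => ξ W)).comap Subtype.val := rfl
  rw [h]
  simp only [MeasurableSpace.comap_iSup, MeasurableSpace.comap_comp]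
  rfl

/-- The configuration `ξ + δ_u`. -/
noncomputable def CountingMeasure.addPoint {U : Type*} [MeasurableSpace U]
    (ξ : CountingMeasure U) (u : U) : CountingMeasure U :=
  ⟨(ξ : Measure U) + Measure.dirac u, by
    obtain ⟨ξ, hσ, hξ⟩ := ξ
    refine ⟨inferInstanceAs (SigmaFinite (ξ + Measure.dirac u)), fun W hW => ?_⟩
    rw [Measure.add_apply, Measure.dirac_apply' u hW]
    rcases hξ W hW with h | ⟨n, h⟩
    · exact Or.inl (by simp [h])
    · right
      by_cases hu : u ∈ W
      · exact ⟨n + 1, by simp [h, hu]⟩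
      · exact ⟨n, by simp [h, hu]⟩⟩

/-- The difference operator `D_u f (ξ) = f (ξ + δ_u) - f ξ`. -/
noncomputable def diffOp {U : Type*} [MeasurableSpace U] (u : U)
    (f : CountingMeasure U → ℝ) (ξ : CountingMeasure U) : ℝ :=
  f (ξ.addPoint u) - f ξ

/-- The Poisson distribution with parameter `r ∈ [0, ∞]`, as a law on `[0, ∞]`; for `r = ∞` it is
the point mass at `∞`. -/
noncomputable def extPoissonMeasure (r : ℝ≥0∞) : Measure ℝ≥0∞ :=
  if r = ∞ then Measure.dirac ∞ else (poissonMeasure r.toNNReal).map (fun n : ℕ => (n : ℝ≥0∞))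

/-- `η` is a Poisson point process on `U` with intensity measure `μ`, defined on the probability
space `(Ω, P)`: a random element of `𝐍_σ` such that `η W` is Poisson distributed with parameter
`μ W` for each measurable `W`, and `η W₁, …, η Wₘ` are independent for disjoint measurable
`W₁, …, Wₘ`. -/
structure IsPoissonProcess {Ω U : Type*} [MeasurableSpace Ω] [MeasurableSpace U]
    (η : Ω → CountingMeasure U) (μ : Measure U) (P : Measure Ω) : Prop where
  measurable : Measurable η
  law : ∀ W : Set U, MeasurableSet W →
    P.map (fun ω => (η ω : Measure U) W) = extPoissonMeasure (μ W)
  indep : ∀ (m : ℕ) (W : Fin m → Set U), (∀ i, MeasurableSet (W i)) →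
    Pairwise (fun i j => Disjoint (W i) (W j)) →
    iIndepFun (fun (i : Fin m) (ω : Ω) => (η ω : Measure U) (W i)) P

/-- The norm `‖G‖_{L^p_ω L^q_u}` of `G : Ω → U → ℝ`: first the `L^q` norm in `u`, then the `L^p` norm
in `ω`. -/
noncomputable def mixedNorm {Ω U : Type*} [MeasurableSpace Ω] [MeasurableSpace U]
    (p q : ℝ) (P : Measure Ω) (μ : Measure U) (G : Ω → U → ℝ) : ℝ≥0∞ :=
  eLpNorm (fun ω => eLpNorm (G ω) (ENNReal.ofReal q) μ) (ENNReal.ofReal p) P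

/-- The norm of the intersection `L^p_ω L^2_u ∩ L^p_ω L^p_u`. -/
noncomputable def interNorm {Ω U : Type*} [MeasurableSpace Ω] [MeasurableSpace U]
    (p : ℝ) (P : Measure Ω) (μ : Measure U) (G : Ω → U → ℝ) : ℝ≥0∞ :=
  max (mixedNorm p 2 P μ G) (mixedNorm p p P μ G)

/-- The norm `‖G‖_{Σ_u^S L^p_ω} = ∑_{q ∈ S} ‖G‖_{L^q_u L^p_ω}` for a finite set `S` of exponents. -/
noncomputable def sigmaNorm {Ω U : Type*} [MeasurableSpace Ω] [MeasurableSpace U]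
    (S : Finset ℝ) (p : ℝ) (P : Measure Ω) (μ : Measure U) (G : Ω → U → ℝ) : ℝ≥0∞ :=
  ∑ q ∈ S, mixedNorm q p μ P (fun u ω => G ω u)

/-!
For a Poisson variable with mean `r` the Poincaré inequality `Var g ≤ r E (g (n + 1) - g n)²`
follows by integrating `(g m - g n)² ≤ (n - m) ∑_{m ≤ j < n} (g (j + 1) - g j)²` over two
independent copies and applying the Stein–Chen identity. The law of total variance extends it to
independent Poisson variables, hence to functionals of finitely many counts `ξ (A i)`. On a set `S`
of finite intensity such functionals are dense in `L²`. As `S ↑ U`, gluing an independent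
configuration off `S` to the given one on `S` yields `Var f ≤ E ∫ |D_u f|² dμ(u)` for bounded `f`.

For `p > 2` this is applied to `|f| ^ (p / 2)`, whose squared increments are at most a multiple of
`|f| ^ (p - 2) |D_u f|² + |D_u f| ^ p`. With `N = ‖f‖_p` and `R = |E f| + M`, where `M` is either of
the two norms of `D_u f`, Hölder's inequality and the interpolation of `E |f| ^ (p / 2)` between
`L¹` and `L^p` give `N ^ p ≤ R ^ a N ^ (p - a) + c (R² N ^ (p - 2) + R ^ p)` with `a = p / (p - 1)`,
hence `N ≤ (1 + 2 c) R`. Truncation and Fatou's lemma remove the boundedness of `f`.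
-/

section Variance

variable {X Y : Type*} [MeasurableSpace X] [MeasurableSpace Y] {ν : Measure X} {ρ : Measure Y}

theorem lintegral_enorm_sub_const_sq [IsProbabilityMeasure ν] {g : X → ℝ}
    (hg : AEStronglyMeasurable g ν) (a : ℝ) :
    ∫⁻ x, ‖g x - a‖ₑ ^ 2 ∂ν = evariance g ν + ‖ν[g] - a‖ₑ ^ 2 := by
  by_cases h : MemLp g 2 ν
  · have hg1 := h.integrable one_le_two
    have hsub : MemLp (fun x => g x - a) 2 ν := h.sub (memLp_const a)
    have hvar := variance_eq_sub hsub
    rw [variance_sub_const hg, integral_sub hg1 (integrable_const a)] at hvar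
    have hsq : ∫ x, (g x - a) ^ 2 ∂ν = Var[g; ν] + (ν[g] - a) ^ 2 := by
      simp only [Pi.pow_apply, integral_const, probReal_univ, one_smul] at hvar
      linarith
    simp_rw [← ofReal_variance h, ← enorm_pow]
    rw [← ofReal_integral_norm_eq_lintegral_enorm hsub.integrable_sq, Real.enorm_of_nonneg
      (sq_nonneg _), ← ENNReal.ofReal_add (variance_nonneg _ _) (sq_nonneg _), ← hsq]
    simp_rw [norm_pow, Real.norm_eq_abs, sq_abs]
  · have hsub : ¬MemLp (g - fun _ => a) 2 ν := fun h' =>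
      h <| by simpa only [sub_add_cancel] using h'.add (memLp_const a)
    have hdef := evariance_def' (hg.sub aestronglyMeasurable_const (g := fun _ => a))
    rw [evariance_eq_top (hg.sub aestronglyMeasurable_const) hsub, eq_comm,
      ENNReal.sub_eq_top_iff] at hdef
    rw [evariance_eq_top hg h, top_add]
    exact hdef.1

theorem evariance_le_lintegral_enorm_sub_const_sq [IsProbabilityMeasure ν] {g : X → ℝ}
    (hg : AEStronglyMeasurable g ν) (a : ℝ) : evariance g ν ≤ ∫⁻ x, ‖g x - a‖ₑ ^ 2 ∂ν :=
  (lintegral_enorm_sub_const_sq hg a).symm ▸ le_self_add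

theorem lintegral_lintegral_enorm_sub_sq [IsProbabilityMeasure ν] {g : X → ℝ}
    (hg : AEStronglyMeasurable g ν) :
    ∫⁻ x, ∫⁻ y, ‖g x - g y‖ₑ ^ 2 ∂ν ∂ν = 2 * evariance g ν := by
  have h (x : X) : ∫⁻ y, ‖g x - g y‖ₑ ^ 2 ∂ν = evariance g ν + ‖g x - ν[g]‖ₑ ^ 2 := by
    simp_rw [enorm_sub_rev (g x), lintegral_enorm_sub_const_sq hg]
  simp_rw [h]
  rw [lintegral_add_left measurable_const, lintegral_const, measure_univ, mul_one, two_mul,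
    ← evariance]

theorem enorm_integral_sq_le [IsProbabilityMeasure ν] {g : X → ℝ}
    (hg : AEStronglyMeasurable g ν) : ‖∫ x, g x ∂ν‖ₑ ^ 2 ≤ ∫⁻ x, ‖g x‖ₑ ^ 2 ∂ν := by
  have h := lintegral_enorm_sub_const_sq hg 0
  simp only [sub_zero] at h
  exact h ▸ le_add_self

theorem enorm_integral_sub_integral_sq_le [IsProbabilityMeasure ν] {f g : X → ℝ}
    (hf : AEStronglyMeasurable f ν) (hg : AEStronglyMeasurable g ν) :
    ‖∫ x, f x ∂ν - ∫ x, g x ∂ν‖ₑ ^ 2 ≤ ∫⁻ x, ‖f x - g x‖ₑ ^ 2 ∂ν := by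
  by_cases hint : Integrable f ν ∧ Integrable g ν
  · rw [← integral_sub hint.1 hint.2]
    exact enorm_integral_sq_le (hf.sub hg)
  by_cases hL2 : MemLp (f - g) 2 ν
  · have hsub := hL2.integrable one_le_two
    have hfg : ¬Integrable f ν ∧ ¬Integrable g ν :=
      ⟨fun h => hint ⟨h, by simpa using h.sub hsub⟩, fun h => hint ⟨by simpa using hsub.add h, h⟩⟩
    simp [integral_undef hfg.1, integral_undef hfg.2]
  · have := lintegral_enorm_sub_const_sq (hf.sub hg) 0
    rw [evariance_eq_top (hf.sub hg) hL2, top_add] at this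
    simp_all

theorem evariance_prod [IsProbabilityMeasure ν] [IsProbabilityMeasure ρ] {g : X × Y → ℝ}
    (hg : Measurable g) :
    evariance g (ν.prod ρ) = ∫⁻ y, evariance (fun x => g (x, y)) ν ∂ρ +
      evariance (fun y => ∫ x, g (x, y) ∂ν) ρ := by
  set a := ∫ z, g z ∂ν.prod ρ with ha
  have hH : Measurable fun y => ∫ x, g (x, y) ∂ν :=
    hg.stronglyMeasurable.integral_prod_left'.measurable
  have key : evariance g (ν.prod ρ) = ∫⁻ y, evariance (fun x => g (x, y)) ν ∂ρ +
      evariance (fun y => ∫ x, g (x, y) ∂ν) ρ + ‖∫ y, ∫ x, g (x, y) ∂ν ∂ρ - a‖ₑ ^ 2 := by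
    rw [add_assoc, ← lintegral_enorm_sub_const_sq hH.aestronglyMeasurable,
      ← lintegral_add_right _ (by fun_prop), evariance, lintegral_prod_symm _ (by fun_prop)]
    exact lintegral_congr fun y =>
      lintegral_enorm_sub_const_sq (hg.comp measurable_prodMk_right).aestronglyMeasurable a
  by_cases hint : Integrable g (ν.prod ρ)
  · rw [key, ha, integral_prod_symm g hint, sub_self]
    simp
  · have htop := evariance_eq_top hg.aestronglyMeasurable fun h => hint (h.integrable one_le_two)
    rw [htop, eq_comm, ENNReal.add_eq_top, or_iff_left (by finiteness)] at key
    rw [htop, key]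

theorem evariance_comp_of_measurePreserving {φ : X → Y} (hφ : MeasurePreserving φ ν ρ) {g : Y → ℝ}
    (hg : AEStronglyMeasurable g ρ) : evariance (g ∘ φ) ν = evariance g ρ := by
  have hmean : ∫ x, g (φ x) ∂ν = ∫ y, g y ∂ρ := by
    rw [← hφ.map_eq, integral_map hφ.aemeasurable (hφ.map_eq ▸ hg)]
  simp_rw [evariance, Function.comp_apply, hmean]
  rw [← hφ.map_eq, lintegral_map' _ hφ.aemeasurable]
  rw [hφ.map_eq]
  have := hg.aemeasurable
  fun_prop

end Variance

section PoissonVariable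

theorem natCast_succ_mul_poissonMeasure_singleton (r : ℝ≥0) (n : ℕ) :
    ((n + 1 : ℕ) : ℝ≥0∞) * poissonMeasure r {n + 1} = r * poissonMeasure r {n} := by
  rw [poissonMeasure_singleton, poissonMeasure_singleton, ← ENNReal.ofReal_natCast,
    ← ENNReal.ofReal_coe_nnreal, ← ENNReal.ofReal_mul (by positivity),
    ← ENNReal.ofReal_mul (by positivity), Nat.factorial_succ]
  congr 1
  push_cast
  field_simp
  ring

theorem lintegral_natCast_mul_poissonMeasure (r : ℝ≥0) (h : ℕ → ℝ≥0∞) :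
    ∫⁻ n, n * h n ∂poissonMeasure r = r * ∫⁻ n, h (n + 1) ∂poissonMeasure r := by
  rw [lintegral_countable', lintegral_countable', tsum_eq_zero_add' ENNReal.summable,
    ← ENNReal.tsum_mul_left]
  simp only [Nat.cast_zero, zero_mul, zero_add]
  refine tsum_congr fun n => ?_
  rw [mul_right_comm, natCast_succ_mul_poissonMeasure_singleton]
  ring

theorem setLIntegral_natCast_poissonMeasure (r : ℝ≥0) (A : Set ℕ) :
    ∫⁻ n in A, n ∂poissonMeasure r = r * poissonMeasure r ((· + 1) ⁻¹' A) := by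
  rw [← lintegral_indicator A.to_countable.measurableSet,
    ← lintegral_indicator_one (Set.to_countable _).measurableSet]
  convert lintegral_natCast_mul_poissonMeasure r (A.indicator 1) using 3 with n
  · by_cases hn : n ∈ A <;> simp [hn]
  · rfl

/-- After `(g m - g n)² ≤ (n - m) ∑_{m ≤ j < n} (g (j + 1) - g j)²` is integrated over independent
`m` and `n`, the left-hand side is the weight of the `j`-th increment of `g`. -/
theorem lintegral_lintegral_ite_mem_Ico_poissonMeasure (r : ℝ≥0) (j : ℕ) :
    ∫⁻ m, ∫⁻ n, (if j ∈ Finset.Ico m n then ((n - m : ℕ) : ℝ≥0∞) else 0)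
      ∂poissonMeasure r ∂poissonMeasure r = r * poissonMeasure r {j} := by
  set π := poissonMeasure r
  have hIic : π (Set.Iic j) = π (Set.Iio j) + π {j} := by
    rw [← measure_union (by simp) (measurableSet_singleton j), Set.Iio_union_right]
  have hIci : π (Set.Ici j) = π {j} + π (Set.Ioi j) := by
    rw [← measure_union (by simp) measurableSet_Ioi, ← Set.Ioi_insert, Set.insert_eq]
  have htotal : π (Set.Iio j) + π {j} + π (Set.Ioi j) = 1 := by
    rw [← hIic, ← Set.compl_Iic]
    exact prob_add_prob_compl measurableSet_Iic
  have hsplit (m n : ℕ) : (if j ∈ Finset.Ico m n then ((n - m : ℕ) : ℝ≥0∞) else 0) +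
      (Set.Iic j).indicator (↑) m * (Set.Ioi j).indicator 1 n =
        (Set.Iic j).indicator 1 m * (Set.Ioi j).indicator (↑) n := by
    have hsub (hm : m ≤ j) (hn : j < n) : (n : ℝ≥0∞) - m + m = n :=
      tsub_add_cancel_of_le (by exact_mod_cast hm.trans hn.le)
    by_cases hm : m ≤ j <;> by_cases hn : j < n <;> simp [hm, hn, hsub]
  have hmean_Iic : ∫⁻ n in Set.Iic j, (n : ℝ≥0∞) ∂π = r * π (Set.Iio j) := by
    rw [setLIntegral_natCast_poissonMeasure]
    congr 2
  have hmean_Ioi : ∫⁻ n in Set.Ioi j, (n : ℝ≥0∞) ∂π = r * π (Set.Ici j) := by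
    rw [setLIntegral_natCast_poissonMeasure]
    congr 2 with n
    simp
  have hint := congr_arg (fun F : ℕ → ℕ → ℝ≥0∞ => ∫⁻ m, ∫⁻ n, F m n ∂π ∂π)
    (funext₂ hsplit)
  have hs (s : Set ℕ) : MeasurableSet s := s.to_countable.measurableSet
  simp only [lintegral_add_right _ (measurable_of_countable _),
    lintegral_const_mul _ (measurable_of_countable _),
    lintegral_mul_const _ (measurable_of_countable _), lintegral_indicator (hs _),
    Pi.one_apply, setLIntegral_one, hmean_Iic, hmean_Ioi, hIic, hIci] at hint
  rw [← ENNReal.add_left_inj (a := r * π (Set.Iio j) * π (Set.Ioi j)) (by finiteness), hint]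
  calc (π (Set.Iio j) + π {j}) * (r * (π {j} + π (Set.Ioi j)))
    _ = r * π {j} * (π (Set.Iio j) + π {j} + π (Set.Ioi j)) +
        r * π (Set.Iio j) * π (Set.Ioi j) := by ring
    _ = r * π {j} + r * π (Set.Iio j) * π (Set.Ioi j) := by rw [htotal, mul_one]

theorem enorm_sub_sq_le_mul_sum_Ico (g : ℕ → ℝ) {m n : ℕ} (h : m ≤ n) :
    ‖g m - g n‖ₑ ^ 2 ≤
      ∑ j ∈ Finset.Ico m n, ((n - m : ℕ) : ℝ≥0∞) * ‖g (j + 1) - g j‖ₑ ^ 2 := by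
  have hsq : (g m - g n) ^ 2 ≤
      ∑ j ∈ Finset.Ico m n, ((n - m : ℕ) : ℝ) * (g (j + 1) - g j) ^ 2 := by
    rw [← neg_sq, neg_sub, ← Finset.sum_Ico_sub g h, ← Finset.mul_sum, ← Nat.card_Ico]
    exact sq_sum_le_card_mul_sum_sq
  rw [← enorm_pow, Real.enorm_of_nonneg (sq_nonneg _)]
  refine (ENNReal.ofReal_le_ofReal hsq).trans_eq ?_
  rw [ENNReal.ofReal_sum_of_nonneg fun _ _ => by positivity]
  refine Finset.sum_congr rfl fun j _ => ?_
  rw [ENNReal.ofReal_mul (by positivity), ENNReal.ofReal_natCast, ← enorm_pow,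
    Real.enorm_of_nonneg (sq_nonneg _)]

theorem evariance_poissonMeasure_le (r : ℝ≥0) (g : ℕ → ℝ) :
    evariance g (poissonMeasure r) ≤ r * ∫⁻ n, ‖g (n + 1) - g n‖ₑ ^ 2 ∂poissonMeasure r := by
  set π := poissonMeasure r
  let w (m n : ℕ) : ℝ≥0∞ :=
    ∑ j ∈ Finset.Ico m n, ((n - m : ℕ) : ℝ≥0∞) * ‖g (j + 1) - g j‖ₑ ^ 2
  have hmeas (h : ℕ → ℝ≥0∞) : Measurable h := measurable_of_countable h
  have hle (m n : ℕ) : ‖g m - g n‖ₑ ^ 2 ≤ w m n + w n m := by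
    rcases le_total m n with h | h
    · exact (enorm_sub_sq_le_mul_sum_Ico g h).trans le_self_add
    · rw [enorm_sub_rev]
      exact (enorm_sub_sq_le_mul_sum_Ico g h).trans le_add_self
  have hw : ∫⁻ m, ∫⁻ n, w m n ∂π ∂π = r * ∫⁻ n, ‖g (n + 1) - g n‖ₑ ^ 2 ∂π := by
    have hw' (m n : ℕ) : w m n = ∑' j, (if j ∈ Finset.Ico m n then ((n - m : ℕ) : ℝ≥0∞) else 0) *
        ‖g (j + 1) - g j‖ₑ ^ 2 := by
      rw [tsum_eq_sum (s := Finset.Ico m n) fun j hj => by simp [hj]]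
      exact Finset.sum_congr rfl fun j hj => by simp [hj]
    simp only [hw', lintegral_tsum fun _ => (measurable_of_countable _).aemeasurable,
      lintegral_mul_const _ (measurable_of_countable _), π,
      lintegral_lintegral_ite_mem_Ico_poissonMeasure]
    rw [lintegral_countable', ← ENNReal.tsum_mul_left]
    exact tsum_congr fun j => by ring
  have h2 : 2 * evariance g π ≤ 2 * ∫⁻ m, ∫⁻ n, w m n ∂π ∂π := calc
    2 * evariance g π = ∫⁻ m, ∫⁻ n, ‖g m - g n‖ₑ ^ 2 ∂π ∂π :=
      (lintegral_lintegral_enorm_sub_sq (measurable_of_countable g).aestronglyMeasurable).symm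
    _ ≤ ∫⁻ m, ∫⁻ n, (w m n + w n m) ∂π ∂π := lintegral_mono fun m => lintegral_mono (hle m)
    _ = 2 * ∫⁻ m, ∫⁻ n, w m n ∂π ∂π := by
      simp_rw [lintegral_add_left (hmeas _)]
      rw [lintegral_lintegral_swap (f := fun m n => w n m) (measurable_of_countable _).aemeasurable,
        two_mul]
  rwa [ENNReal.mul_le_mul_iff_right (by simp) (by simp), hw] at h2

theorem measurePreserving_finCons {k : ℕ} {α : Fin (k + 1) → Type*} [∀ i, MeasurableSpace (α i)]
    (μ : ∀ i, Measure (α i)) [∀ i, SigmaFinite (μ i)] :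
    MeasurePreserving (fun z : α 0 × (∀ i : Fin k, α i.succ) => Fin.cons z.1 z.2)
      ((μ 0).prod (Measure.pi fun i => μ i.succ)) (Measure.pi μ) := by
  convert! (measurePreserving_piFinSuccAbove μ 0).symm using 1
  ext z : 1
  exact (Fin.insertNth_zero _ _).symm

theorem evariance_pi_poissonMeasure_le {k : ℕ} (r : Fin k → ℝ≥0) (g : (Fin k → ℕ) → ℝ) :
    evariance g (Measure.pi fun i => poissonMeasure (r i)) ≤ ∑ i, r i *
      ∫⁻ n, ‖g (n + Pi.single i 1) - g n‖ₑ ^ 2 ∂Measure.pi fun i => poissonMeasure (r i) := by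
  induction k with
  | zero =>
    rw [Measure.pi_of_empty (x := default)]
    simp [evariance]
  | succ k ih =>
    let π := poissonMeasure (r 0)
    let ρ := Measure.pi fun i : Fin k => poissonMeasure (r i.succ)
    have hpres : MeasurePreserving (fun z : ℕ × (Fin k → ℕ) => (Fin.cons z.1 z.2 : Fin (k + 1) → ℕ))
        (π.prod ρ) (Measure.pi fun i => poissonMeasure (r i)) :=
      measurePreserving_finCons fun i => poissonMeasure (r i)
    have hlin (h : (Fin (k + 1) → ℕ) → ℝ≥0∞) :
        ∫⁻ n, h n ∂Measure.pi (fun i => poissonMeasure (r i)) =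
          ∫⁻ y, ∫⁻ x, h (Fin.cons x y) ∂π ∂ρ := by
      rw [← hpres.lintegral_comp (measurable_of_countable h), lintegral_prod_symm _ (by fun_prop)]
    have hsucc (x : ℕ) (y : Fin k → ℕ) (i : Fin k) :
        (Fin.cons x y + Pi.single i.succ 1 : Fin (k + 1) → ℕ) = Fin.cons x (y + Pi.single i 1) := by
      ext l
      refine Fin.cases ?_ (fun j => ?_) l <;> simp [Pi.single_apply]
    have hzero (x : ℕ) (y : Fin k → ℕ) :
        (Fin.cons x y + Pi.single 0 1 : Fin (k + 1) → ℕ) = Fin.cons (x + 1) y := by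
      ext l
      refine Fin.cases ?_ (fun j => ?_) l <;> simp
    rw [← evariance_comp_of_measurePreserving hpres
        (measurable_of_countable g).aestronglyMeasurable,
      evariance_prod (measurable_of_countable _), Fin.sum_univ_succ]
    simp_rw [hlin, hzero, hsucc]
    refine add_le_add ?_ ((ih _ _).trans ?_)
    · rw [← lintegral_const_mul _ (measurable_of_countable _)]
      exact lintegral_mono fun y => evariance_poissonMeasure_le (r 0) _
    · gcongr with i _ y
      exact enorm_integral_sub_integral_sq_le (measurable_of_countable _).aestronglyMeasurable
        (measurable_of_countable _).aestronglyMeasurable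

end PoissonVariable

section Cylinder

theorem exists_measurable_restrict_eLpNorm_sub_le {ι : Type*} {E : ι → Type*}
    [∀ i, MeasurableSpace (E i)] {ν : Measure (∀ i, E i)} [IsFiniteMeasure ν] {p : ℝ≥0∞}
    (hp : p ≠ ∞) {f : (∀ i, E i) → ℝ} (hf : MemLp f p ν) {ε : ℝ≥0∞} (hε : ε ≠ 0) :
    ∃ (T : Finset ι) (g : (∀ i : T, E i) → ℝ), Measurable g ∧
      eLpNorm (f - g ∘ T.restrict) p ν ≤ ε := by
  classical
  suffices ∃ c, eLpNorm (f - c) p ν ≤ ε ∧ ∃ (T : Finset ι) (g : (∀ i : T, E i) → ℝ),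
      Measurable g ∧ c = g ∘ T.restrict by
    obtain ⟨_, hc, T, g, hg, rfl⟩ := this
    exact ⟨T, g, hg, hc⟩
  refine MemLp.induction_dense hp _ ?_ ?_ ?_ hf hε
  · intro a s hs _ ε hε
    obtain ⟨δ, hδ, hδε⟩ := exists_eLpNorm_indicator_le (μ := ν) hp a hε
    obtain ⟨t, ht, hst⟩ := (Measure.MeasureDense.of_generateFrom_isSetAlgebra_finite ν
      isSetAlgebra_measurableCylinders generateFrom_measurableCylinders.symm).approx s hs
      (measure_ne_top _ _) δ (by exact_mod_cast hδ)
    obtain ⟨T, B, hB, rfl⟩ := (mem_measurableCylinders t).1 ht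
    refine ⟨(cylinder T B).indicator fun _ => a, ?_, T, B.indicator fun _ => a,
      measurable_const.indicator hB, rfl⟩
    rw [eLpNorm_indicator_sub_indicator, symmDiff_comm]
    exact hδε _ (by simpa using hst.le)
  · rintro _ _ ⟨T, g, hg, rfl⟩ ⟨T', g', hg', rfl⟩
    exact ⟨T ∪ T', g ∘ Finset.restrict₂ Finset.subset_union_left +
      g' ∘ Finset.restrict₂ Finset.subset_union_right,
      (hg.comp (by fun_prop)).add (hg'.comp (by fun_prop)), rfl⟩
  · rintro _ ⟨T, g, hg, rfl⟩
    exact (hg.comp (by fun_prop)).aestronglyMeasurable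

theorem exists_finset_eLpNorm_sub_le {X ι E : Type*} [MeasurableSpace E] {mX : MeasurableSpace X}
    {φ : X → ι → E} (hφ : mX = MeasurableSpace.pi.comap φ) {ν : Measure X} [IsFiniteMeasure ν]
    {p : ℝ≥0∞} (hp : p ≠ ∞) {f : X → ℝ} (hf : Measurable f) (hfp : MemLp f p ν)
    {ε : ℝ≥0∞} (hε : ε ≠ 0) :
    ∃ (T : Finset ι) (g : (T → E) → ℝ), Measurable g ∧
      eLpNorm (f - fun x => g fun i => φ x i) p ν ≤ ε := by
  have hf' : Measurable[MeasurableSpace.pi.comap φ] f := hφ ▸ hf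
  obtain ⟨F, hF, rfl⟩ := hf'.exists_eq_measurable_comp
  have hφm : Measurable φ := by rw [hφ]; exact comap_measurable φ
  have hmap : MemLp F p (ν.map φ) :=
    (memLp_map_measure_iff hF.aestronglyMeasurable hφm.aemeasurable).2 hfp
  obtain ⟨T, g, hg, hle⟩ := exists_measurable_restrict_eLpNorm_sub_le hp hmap hε
  refine ⟨T, g, hg, ?_⟩
  rwa [eLpNorm_map_measure (hF.sub (hg.comp (by fun_prop))).aestronglyMeasurable
    hφm.aemeasurable] at hle

end Cylinder

section Partition

variable {U : Type*} [MeasurableSpace U]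

/-- The sets `A i` are the atoms of the algebra of sets generated by the sets `W j`. -/
theorem exists_pairwise_disjoint_measure_eq_sum {κ : Type*} [Finite κ] {W : κ → Set U}
    (hW : ∀ j, MeasurableSet (W j)) :
    ∃ (k : ℕ) (A : Fin k → Set U) (I : κ → Finset (Fin k)), (∀ i, MeasurableSet (A i)) ∧
      Pairwise (Function.onFun Disjoint A) ∧
      ∀ (ν : Measure U) (j : κ), ν (W j) = ∑ i ∈ I j, ν (A i) := by
  classical
  obtain ⟨k, ⟨e⟩⟩ := Finite.exists_equiv_fin (Set κ)
  let c : U → Fin k := fun u => e {j | u ∈ W j}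
  have hc : Measurable c := (measurable_of_countable e).comp
    (measurable_set_iff.2 fun j => measurableSet_setOfPred.1 (hW j))
  have hA (i : Fin k) : MeasurableSet (c ⁻¹' {i}) := hc (measurableSet_singleton i)
  refine ⟨k, fun i => c ⁻¹' {i}, fun j => Finset.univ.filter fun i => j ∈ e.symm i, hA,
    pairwise_disjoint_fiber c, fun ν j => ?_⟩
  rw [sum_measure_preimage_singleton _ fun i _ => hA i]
  congr 1
  ext u
  simp [c]

end Partition

theorem measurable_comap_pi_apply {X ι E : Type*} [MeasurableSpace E] (φ : X → ι → E) (i : ι) :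
    Measurable[MeasurableSpace.pi.comap φ] fun x => φ x i :=
  (measurable_pi_apply i).comp (comap_measurable φ)

namespace CountingMeasure

variable {X U : Type*} [MeasurableSpace X] [MeasurableSpace U]

theorem measurable_eval {W : Set U} (hW : MeasurableSet W) :
    Measurable fun ξ : CountingMeasure U => (ξ : Measure U) W :=
  (Measure.measurable_coe hW).comp measurable_subtype_coe

theorem measurable_of_eval {f : X → CountingMeasure U}
    (h : ∀ W, MeasurableSet W → Measurable fun x => (f x : Measure U) W) : Measurable f :=
  (Measure.measurable_of_measurable_coe _ h).subtype_mk

theorem measurableSpace_eq_comap_eval {ι : Type*} {W : ι → Set U} (hW : ∀ i, MeasurableSet (W i))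
    (h : ∀ V, MeasurableSet V →
      Measurable[MeasurableSpace.pi.comap fun (ξ : CountingMeasure U) i => (ξ : Measure U) (W i)]
        fun ξ : CountingMeasure U => (ξ : Measure U) V) :
    (inferInstance : MeasurableSpace (CountingMeasure U)) =
      MeasurableSpace.pi.comap fun (ξ : CountingMeasure U) i => (ξ : Measure U) (W i) := by
  refine le_antisymm ?_ (measurable_pi_lambda _ fun i => measurable_eval (hW i)).comap_le
  rw [← MeasurableSpace.comap_id (m := inferInstance)]
  exact Measurable.comap_le (@measurable_of_eval _ U (_) _ id h)

variable (U) in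
theorem measurableSpace_eq_comap_eval_measurableSet :
    (inferInstance : MeasurableSpace (CountingMeasure U)) = MeasurableSpace.pi.comap
      fun (ξ : CountingMeasure U) (W : {W : Set U // MeasurableSet W}) => (ξ : Measure U) W :=
  measurableSpace_eq_comap_eval (fun W => W.2) fun V hV =>
    measurable_comap_pi_apply _ (⟨V, hV⟩ : {W : Set U // MeasurableSet W})

theorem measurableSpace_eq_comap_eval_subset {S : ℕ → Set U} (hS : Monotone S)
    (hSm : ∀ m, MeasurableSet (S m)) (hSU : ⋃ m, S m = Set.univ) :
    (inferInstance : MeasurableSpace (CountingMeasure U)) = MeasurableSpace.pi.comap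
      fun (ξ : CountingMeasure U) (W : {W : Set U // MeasurableSet W ∧ ∃ m, W ⊆ S m}) =>
        (ξ : Measure U) W := by
  refine measurableSpace_eq_comap_eval (fun W => W.2.1) fun V hV => ?_
  have hsup (ξ : CountingMeasure U) : (ξ : Measure U) V = ⨆ m, (ξ : Measure U) (V ∩ S m) := by
    rw [← Monotone.measure_iUnion fun _ _ h => Set.inter_subset_inter_right V (hS h),
      ← Set.inter_iUnion, hSU, Set.inter_univ]
  simp_rw [hsup]
  refine Measurable.iSup fun m => ?_
  let W : {W : Set U // MeasurableSet W ∧ ∃ m, W ⊆ S m} :=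
    ⟨V ∩ S m, hV.inter (hSm m), m, Set.inter_subset_right⟩
  exact measurable_comap_pi_apply _ W

theorem addPoint_apply (ξ : CountingMeasure U) (u : U) {W : Set U} (hW : MeasurableSet W) :
    (ξ.addPoint u : Measure U) W = (ξ : Measure U) W + W.indicator 1 u := by
  simp only [addPoint, Measure.add_apply, Measure.dirac_apply' _ hW]

theorem measurable_addPoint :
    Measurable fun z : CountingMeasure U × U => z.1.addPoint z.2 :=
  measurable_of_eval fun W hW => by
    simp_rw [addPoint_apply _ _ hW]
    exact ((measurable_eval hW).comp measurable_fst).add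
      ((measurable_one.indicator hW).comp measurable_snd)

variable {S : Set U} (hS : MeasurableSet S)

/-- The restriction of the configuration `ξ` to `S`. -/
noncomputable def restrict (ξ : CountingMeasure U) : CountingMeasure U :=
  ⟨(ξ : Measure U).restrict S, by
    obtain ⟨ξ, hσ, hξ⟩ := ξ
    refine ⟨inferInstanceAs (SigmaFinite (ξ.restrict S)), fun W hW => ?_⟩
    rw [Measure.restrict_apply hW]
    exact hξ _ (hW.inter hS)⟩

/-- The configuration which agrees with `ξ` on `S` and with `ζ` off `S`. -/
noncomputable def glue (ξ ζ : CountingMeasure U) : CountingMeasure U :=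
  ⟨(ξ : Measure U).restrict S + (ζ : Measure U).restrict Sᶜ, by
    obtain ⟨ξ, hσ, hξ⟩ := ξ
    obtain ⟨ζ, hσ', hζ⟩ := ζ
    refine ⟨inferInstanceAs (SigmaFinite (ξ.restrict S + ζ.restrict Sᶜ)), fun W hW => ?_⟩
    rw [Measure.add_apply, Measure.restrict_apply hW, Measure.restrict_apply hW]
    rcases hξ _ (hW.inter hS) with h | ⟨n, h⟩
    · simp [h]
    rcases hζ _ (hW.inter hS.compl) with h' | ⟨n', h'⟩
    · simp [h']
    · exact Or.inr ⟨n + n', by simp [h, h']⟩⟩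

theorem restrict_apply (ξ : CountingMeasure U) {W : Set U} (hW : MeasurableSet W) :
    (ξ.restrict hS : Measure U) W = (ξ : Measure U) (W ∩ S) :=
  Measure.restrict_apply hW

theorem glue_apply (ξ ζ : CountingMeasure U) {W : Set U} (hW : MeasurableSet W) :
    (glue hS ξ ζ : Measure U) W = (ξ : Measure U) (W ∩ S) + (ζ : Measure U) (W ∩ Sᶜ) := by
  simp only [glue, Measure.add_apply, Measure.restrict_apply hW]

theorem measurable_restrict : Measurable (restrict hS) :=
  measurable_of_eval fun W hW => by
    simp_rw [restrict_apply hS _ hW]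
    exact measurable_eval (hW.inter hS)

theorem measurable_glue : Measurable fun z : CountingMeasure U × CountingMeasure U =>
    glue hS z.1 z.2 :=
  measurable_of_eval fun W hW => by
    simp_rw [glue_apply hS _ _ hW]
    exact ((measurable_eval (hW.inter hS)).comp measurable_fst).add
      ((measurable_eval (hW.inter hS.compl)).comp measurable_snd)

theorem glue_self (ξ : CountingMeasure U) : glue hS ξ ξ = ξ :=
  Subtype.ext (Measure.restrict_add_restrict_compl hS)

theorem glue_restrict_left (ξ ζ : CountingMeasure U) :
    glue hS (ξ.restrict hS) ζ = glue hS ξ ζ :=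
  Subtype.ext (by simp [glue, restrict, Measure.restrict_restrict, hS])

theorem glue_restrict_right (ξ ζ : CountingMeasure U) :
    glue hS ξ (ζ.restrict hS.compl) = glue hS ξ ζ :=
  Subtype.ext (by simp [glue, restrict, Measure.restrict_restrict, hS])

theorem glue_apply_of_subset (ξ ζ : CountingMeasure U) {W : Set U} (hW : MeasurableSet W)
    (hWS : W ⊆ S) : (glue hS ξ ζ : Measure U) W = (ξ : Measure U) W := by
  rw [glue_apply hS _ _ hW, Set.inter_eq_left.2 hWS,
    (Set.disjoint_compl_right_iff_subset.2 hWS).inter_eq, measure_empty, add_zero]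

theorem glue_addPoint (ξ ζ : CountingMeasure U) {u : U} (hu : u ∈ S) :
    glue hS (ξ.addPoint u) ζ = (glue hS ξ ζ).addPoint u :=
  Subtype.ext <| by
    classical
    simp only [glue, addPoint, Measure.restrict_add, restrict_dirac' hS, if_pos hu,
      add_right_comm]

end CountingMeasure

theorem indepFun_of_indepFun_comp {Ω E F E' F' : Type*} [MeasurableSpace Ω] {P : Measure Ω}
    {mE : MeasurableSpace E} {mF : MeasurableSpace F} {mE' : MeasurableSpace E'}
    {mF' : MeasurableSpace F'} {X : Ω → E} {Y : Ω → F} {φ : E → E'} {ψ : F → F'}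
    (hφ : mE = mE'.comap φ) (hψ : mF = mF'.comap ψ) (h : IndepFun (φ ∘ X) (ψ ∘ Y) P) :
    IndepFun X Y P := by
  rw [IndepFun_iff_Indep] at h ⊢
  rwa [hφ, hψ, MeasurableSpace.comap_comp, MeasurableSpace.comap_comp]

namespace IsPoissonProcess

variable {Ω U : Type*} [MeasurableSpace Ω] [MeasurableSpace U] {η : Ω → CountingMeasure U}
  {μ : Measure U} {P : Measure Ω}

theorem measurable_eval (h : IsPoissonProcess η μ P) {W : Set U} (hW : MeasurableSet W) :
    Measurable fun ω => (η ω : Measure U) W :=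
  (CountingMeasure.measurable_eval hW).comp h.measurable

theorem iIndepFun_eval (h : IsPoissonProcess η μ P) {ι : Type*} [Finite ι] {A : ι → Set U}
    (hA : ∀ i, MeasurableSet (A i)) (hd : Pairwise (Function.onFun Disjoint A)) :
    iIndepFun (fun i ω => (η ω : Measure U) (A i)) P := by
  obtain ⟨n, ⟨e⟩⟩ := Finite.exists_equiv_fin ι
  have := h.indep n (fun j => A (e.symm j)) (fun j => hA _)
    fun i j hij => hd (e.symm.injective.ne hij)
  simpa using this.precomp e.injective

theorem isPoissonProcess_id_map (h : IsPoissonProcess η μ P) :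
    IsPoissonProcess id μ (P.map η) where
  measurable := measurable_id
  law W hW := by
    rw [← h.law W hW]
    exact Measure.map_map (CountingMeasure.measurable_eval hW) h.measurable
  indep m W hW hd := by
    have hind := h.indep m W hW hd
    rw [iIndepFun_iff_measure_inter_preimage_eq_mul] at hind ⊢
    intro T B hB
    have hpre (i) (hi : i ∈ T) :
        MeasurableSet ((fun ξ : CountingMeasure U => (ξ : Measure U) (W i)) ⁻¹' B i) :=
      CountingMeasure.measurable_eval (hW i) (hB i hi)
    refine (Measure.map_apply h.measurable (Finset.measurableSet_biInter T hpre)).trans ?_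
    rw [Set.preimage_iInter₂]
    exact (hind T hB).trans (Finset.prod_congr rfl fun i hi =>
      (Measure.map_apply h.measurable (hpre i hi)).symm)

theorem indepFun_inter_inter_compl (h : IsPoissonProcess η μ P) {κ κ' : Type*} [Finite κ]
    [Finite κ'] {W : κ → Set U} {W' : κ' → Set U} (hW : ∀ j, MeasurableSet (W j))
    (hW' : ∀ j, MeasurableSet (W' j)) {S : Set U} (hS : MeasurableSet S) :
    IndepFun (fun ω j => (η ω : Measure U) (W j ∩ S)) (fun ω j => (η ω : Measure U) (W' j ∩ Sᶜ))
      P := by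
  classical
  obtain ⟨k, A, I, hA, hAd, hWA⟩ := exists_pairwise_disjoint_measure_eq_sum hW
  obtain ⟨l, B, J, hB, hBd, hWB⟩ := exists_pairwise_disjoint_measure_eq_sum hW'
  let D : Fin k ⊕ Fin l → Set U := Sum.elim (fun i => A i ∩ S) fun i => B i ∩ Sᶜ
  have hD : ∀ i, MeasurableSet (D i) := by
    rintro (i | i)
    exacts [(hA i).inter hS, (hB i).inter hS.compl]
  have hDd : Pairwise (Function.onFun Disjoint D) := by
    rintro (i | i) (j | j) hij
    · exact (hAd (by simpa using hij)).mono Set.inter_subset_left Set.inter_subset_left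
    · exact disjoint_compl_right.mono Set.inter_subset_right Set.inter_subset_right
    · exact disjoint_compl_left.mono Set.inter_subset_right Set.inter_subset_right
    · exact (hBd (by simpa using hij)).mono Set.inter_subset_left Set.inter_subset_left
  have hind := (h.iIndepFun_eval hD hDd).indepFun_finset (Finset.univ.map .inl)
    (Finset.univ.map .inr) (by simp [Finset.disjoint_left]) fun i => h.measurable_eval (hD i)
  convert hind.comp
    (φ := fun x j => ∑ i ∈ I j, x ⟨Sum.inl i, Finset.mem_map_of_mem _ (Finset.mem_univ i)⟩)
    (ψ := fun x j => ∑ i ∈ J j, x ⟨Sum.inr i, Finset.mem_map_of_mem _ (Finset.mem_univ i)⟩)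
    (by fun_prop) (by fun_prop) using 1
  · ext ω j
    simpa [Measure.restrict_apply, hW j, hA, D] using hWA ((η ω : Measure U).restrict S) j
  · ext ω j
    simpa [Measure.restrict_apply, hW' j, hB, D] using hWB ((η ω : Measure U).restrict Sᶜ) j

theorem indepFun_restrict_restrict_compl [IsProbabilityMeasure P] (h : IsPoissonProcess η μ P)
    {S : Set U} (hS : MeasurableSet S) :
    IndepFun (fun ω => (η ω).restrict hS) (fun ω => (η ω).restrict hS.compl) P := by
  have hσ := CountingMeasure.measurableSpace_eq_comap_eval_measurableSet U
  have hind : IndepFun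
      (fun ω (W : {W : Set U // MeasurableSet W}) => ((η ω).restrict hS : Measure U) W)
      (fun ω (W : {W : Set U // MeasurableSet W}) => ((η ω).restrict hS.compl : Measure U) W)
      P := by
    simp only [CountingMeasure.restrict_apply _ _ (Subtype.prop _)]
    exact IndepFun.process_indepFun_process
      (fun W => h.measurable_eval (W.2.inter hS)) (fun W => h.measurable_eval (W.2.inter hS.compl))
      fun I J => h.indepFun_inter_inter_compl (fun W => W.1.2) (fun W => W.1.2) hS
  exact indepFun_of_indepFun_comp hσ hσ hind

theorem measurePreserving_glue {L : Measure (CountingMeasure U)} [IsProbabilityMeasure L]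
    (h : IsPoissonProcess id μ L) {S : Set U} (hS : MeasurableSet S) :
    MeasurePreserving (fun z => CountingMeasure.glue hS z.1 z.2) (L.prod L) L := by
  have hg := CountingMeasure.measurable_glue hS
  have hr := CountingMeasure.measurable_restrict hS
  have hr' := CountingMeasure.measurable_restrict hS.compl
  have hprod := (indepFun_iff_map_prod_eq_prod_map_map hr.aemeasurable hr'.aemeasurable).1
    (h.indepFun_restrict_restrict_compl hS)
  rw [Measure.map_prod_map _ _ hr hr'] at hprod
  replace hprod := congr_arg (Measure.map fun z => CountingMeasure.glue hS z.1 z.2) hprod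
  rw [Measure.map_map hg (hr.prodMk hr'), Measure.map_map hg (hr.prodMap hr')] at hprod
  refine ⟨hg, ?_⟩
  simpa [Function.comp_def, CountingMeasure.glue_restrict_left,
    CountingMeasure.glue_restrict_right, CountingMeasure.glue_self] using hprod.symm

end IsPoissonProcess

theorem eLpNorm_two_sq_eq_lintegral {X ε : Type*} [MeasurableSpace X] [ENorm ε] (ν : Measure X)
    (f : X → ε) : eLpNorm f 2 ν ^ 2 = ∫⁻ x, ‖f x‖ₑ ^ 2 ∂ν := by
  simpa using eLpNorm_nnreal_pow_eq_lintegral (μ := ν) (f := f) (p := 2) (by norm_num)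

theorem measurable_diffOp {U : Type*} [MeasurableSpace U] {f : CountingMeasure U → ℝ}
    (hf : Measurable f) : Measurable fun z : CountingMeasure U × U => diffOp z.2 f z.1 :=
  (hf.comp CountingMeasure.measurable_addPoint).sub (hf.comp measurable_fst)

theorem CountingMeasure.addPoint_eval_eq_add_single {U ι : Type*} [MeasurableSpace U]
    [DecidableEq ι] {A : ι → Set U} (hA : ∀ i, MeasurableSet (A i))
    (hd : Pairwise (Function.onFun Disjoint A)) {i : ι} {u : U} (hu : u ∈ A i)
    (ξ : CountingMeasure U) :
    (fun j => (ξ.addPoint u : Measure U) (A j)) =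
      (fun j => (ξ : Measure U) (A j)) + Pi.single i 1 := by
  ext j
  rw [CountingMeasure.addPoint_apply _ _ (hA j), Pi.add_apply]
  congr 1
  obtain rfl | hj := eq_or_ne j i
  · simp [hu]
  · simp [hj, Set.disjoint_left.1 (hd hj.symm) hu]

namespace IsPoissonProcess

variable {U : Type*} [MeasurableSpace U] {μ : Measure U} {L : Measure (CountingMeasure U)}

theorem map_eval_eq_map_pi_poissonMeasure (h : IsPoissonProcess id μ L) {k : ℕ}
    {A : Fin k → Set U} (hA : ∀ i, MeasurableSet (A i)) (hd : Pairwise (Function.onFun Disjoint A))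
    (hfin : ∀ i, μ (A i) ≠ ∞) :
    L.map (fun (ξ : CountingMeasure U) i => (ξ : Measure U) (A i)) =
      (Measure.pi fun i => poissonMeasure (μ (A i)).toNNReal).map fun n i => (n i : ℝ≥0∞) := by
  refine ((h.iIndepFun_eval hA hd).map_fun_eq_pi_map
    fun i => (h.measurable_eval (hA i)).aemeasurable).trans ?_
  simp_rw [fun i => h.law (A i) (hA i), extPoissonMeasure, if_neg (hfin _)]
  have (r : ℝ≥0) : IsProbabilityMeasure ((poissonMeasure r).map fun n : ℕ => (n : ℝ≥0∞)) :=
    Measure.isProbabilityMeasure_map (by fun_prop)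
  exact (Measure.pi_map_pi fun i => by fun_prop).symm

theorem evariance_comp_eval_le (h : IsPoissonProcess id μ L) {k : ℕ} {A : Fin k → Set U}
    (hA : ∀ i, MeasurableSet (A i)) (hd : Pairwise (Function.onFun Disjoint A))
    (hfin : ∀ i, μ (A i) ≠ ∞) {g : (Fin k → ℝ≥0∞) → ℝ} (hg : Measurable g)
    {c : CountingMeasure U → ℝ} (hc : ∀ ξ, c ξ = g fun i => (ξ : Measure U) (A i)) :
    evariance c L ≤ ∫⁻ u in ⋃ i, A i, ∫⁻ ξ, ‖diffOp u c ξ‖ₑ ^ 2 ∂L ∂μ := by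
  let X : CountingMeasure U → Fin k → ℝ≥0∞ := fun ξ i => (ξ : Measure U) (A i)
  let N : (Fin k → ℕ) → Fin k → ℝ≥0∞ := fun n i => n i
  let ρ := Measure.pi fun i => poissonMeasure (μ (A i)).toNNReal
  have hX : Measurable X := measurable_pi_lambda _ fun i => CountingMeasure.measurable_eval (hA i)
  have hN : Measurable N := by fun_prop
  have hmap : L.map X = ρ.map N := h.map_eval_eq_map_pi_poissonMeasure hA hd hfin
  have hdiff (i) (u) (hu : u ∈ A i) (ξ) : diffOp u c ξ = g (X ξ + Pi.single i 1) - g (X ξ) := by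
    rw [diffOp, hc, hc, CountingMeasure.addPoint_eval_eq_add_single hA hd hu]
  have hstep (i) : ∫⁻ n, ‖g (N (n + Pi.single i 1)) - g (N n)‖ₑ ^ 2 ∂ρ =
      ∫⁻ ξ, ‖g (X ξ + Pi.single i 1) - g (X ξ)‖ₑ ^ 2 ∂L := by
    have hG : Measurable fun x => ‖g (x + Pi.single i 1) - g x‖ₑ ^ 2 := by fun_prop
    rw [← lintegral_map hG hX, hmap, lintegral_map hG hN]
    congr! with n
    ext j
    obtain rfl | hj := eq_or_ne j i <;> simp [N, *]
  calc evariance c L = evariance (g ∘ N) ρ := by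
        rw [show c = g ∘ X from funext hc,
          evariance_comp_of_measurePreserving ⟨hX, hmap⟩ hg.aestronglyMeasurable,
          evariance_comp_of_measurePreserving ⟨hN, rfl⟩ hg.aestronglyMeasurable]
    _ ≤ ∑ i, μ (A i) * ∫⁻ ξ, ‖g (X ξ + Pi.single i 1) - g (X ξ)‖ₑ ^ 2 ∂L := by
        refine (evariance_pi_poissonMeasure_le _ _).trans_eq ?_
        simp only [Function.comp_apply, ← hstep, ENNReal.coe_toNNReal (hfin _), ρ]
    _ = ∑ i, ∫⁻ u in A i, ∫⁻ ξ, ‖diffOp u c ξ‖ₑ ^ 2 ∂L ∂μ := by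
        refine Finset.sum_congr rfl fun i _ => ?_
        rw [setLIntegral_congr_fun (hA i) fun u hu => by simp only [hdiff i u hu]; rfl,
          setLIntegral_const, mul_comm]
    _ = ∫⁻ u in ⋃ i, A i, ∫⁻ ξ, ‖diffOp u c ξ‖ₑ ^ 2 ∂L ∂μ := by
        rw [lintegral_iUnion hA hd, tsum_fintype]

theorem evariance_comp_eval_inter_le (h : IsPoissonProcess id μ L) {κ : Type*} [Finite κ]
    {W : κ → Set U} (hW : ∀ j, MeasurableSet (W j)) {S : Set U} (hS : MeasurableSet S)
    (hfin : μ S ≠ ∞) {g : (κ → ℝ≥0∞) → ℝ} (hg : Measurable g)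
    {c : CountingMeasure U → ℝ} (hc : ∀ ξ, c ξ = g fun j => (ξ : Measure U) (W j ∩ S)) :
    evariance c L ≤ ∫⁻ u in S, ∫⁻ ξ, ‖diffOp u c ξ‖ₑ ^ 2 ∂L ∂μ := by
  obtain ⟨k, A, I, hA, hd, hsum⟩ := exists_pairwise_disjoint_measure_eq_sum hW
  have hcA (ξ) : c ξ = g fun j => ∑ i ∈ I j, (ξ : Measure U) (A i ∩ S) := by
    rw [hc]
    congr 1
    ext j
    simpa only [Measure.restrict_apply (hW j), Measure.restrict_apply (hA _)] using
      hsum ((ξ : Measure U).restrict S) j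
  refine (h.evariance_comp_eval_le (fun i => (hA i).inter hS)
    (fun i j hij => (hd hij).mono Set.inter_subset_left Set.inter_subset_left)
    (fun i => measure_ne_top_of_subset Set.inter_subset_right hfin)
    (g := fun x => g fun j => ∑ i ∈ I j, x i) (hg.comp (by fun_prop)) hcA).trans ?_
  exact lintegral_mono_set (Set.iUnion_subset fun i => Set.inter_subset_right)

end IsPoissonProcess

theorem eLpNorm_diffOp_le {U : Type*} [MeasurableSpace U] {f : CountingMeasure U → ℝ}
    (hf : Measurable f) (Q : Measure (CountingMeasure U × U)) :
    eLpNorm (fun z => diffOp z.2 f z.1) 2 Q ≤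
      eLpNorm f 2 (Q.map fun z => z.1.addPoint z.2) + eLpNorm f 2 (Q.map Prod.fst) := by
  have hadd := CountingMeasure.measurable_addPoint (U := U)
  rw [eLpNorm_map_measure hf.aestronglyMeasurable hadd.aemeasurable,
    eLpNorm_map_measure hf.aestronglyMeasurable measurable_fst.aemeasurable]
  exact eLpNorm_sub_le (hf.comp hadd).aestronglyMeasurable
    (hf.comp measurable_fst).aestronglyMeasurable (by norm_num)

theorem eLpNorm_sub_integral_le {X : Type*} [MeasurableSpace X] {ν : Measure X}
    [IsProbabilityMeasure ν] {f c : X → ℝ} (hf : AEStronglyMeasurable f ν)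
    (hc : AEStronglyMeasurable c ν) :
    eLpNorm (f - fun _ => ν[f]) 2 ν ≤ eLpNorm (f - c) 2 ν + eLpNorm (c - fun _ => ν[c]) 2 ν := by
  have hmin : eLpNorm (f - fun _ => ν[f]) 2 ν ≤ eLpNorm (f - fun _ => ν[c]) 2 ν := by
    rw [← ENNReal.pow_le_pow_left_iff two_ne_zero, eLpNorm_two_sq_eq_lintegral,
      eLpNorm_two_sq_eq_lintegral]
    exact evariance_le_lintegral_enorm_sub_const_sq hf _
  refine hmin.trans ?_
  rw [← sub_add_sub_cancel f c]
  exact eLpNorm_add_le (hf.sub hc) (hc.sub aestronglyMeasurable_const) (by norm_num)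

section Approximation

variable {U : Type*} [MeasurableSpace U] {f c : CountingMeasure U → ℝ}

theorem evariance_le_lintegral_diffOp_iff {L : Measure (CountingMeasure U)} [SFinite L]
    {μ : Measure U} [SFinite μ] (hf : Measurable f) :
    evariance f L ≤ ∫⁻ u, ∫⁻ ξ, ‖diffOp u f ξ‖ₑ ^ 2 ∂L ∂μ ↔
      eLpNorm (f - fun _ => L[f]) 2 L ≤ eLpNorm (fun z => diffOp z.2 f z.1) 2 (L.prod μ) := by
  have hvar : evariance f L = eLpNorm (f - fun _ => L[f]) 2 L ^ 2 :=
    (eLpNorm_two_sq_eq_lintegral _ _).symm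
  rw [hvar, ← lintegral_prod_symm (fun z : CountingMeasure U × U => ‖diffOp z.2 f z.1‖ₑ ^ 2)
    ((measurable_diffOp hf).enorm.pow_const 2).aemeasurable, ← eLpNorm_two_sq_eq_lintegral,
    ENNReal.pow_le_pow_left_iff two_ne_zero]

theorem eLpNorm_diffOp_le_of_approx {Q : Measure (CountingMeasure U × U)} (hf : Measurable f)
    (hc : Measurable c) :
    eLpNorm (fun z => diffOp z.2 c z.1) 2 Q ≤ eLpNorm (fun z => diffOp z.2 f z.1) 2 Q +
      (eLpNorm (f - c) 2 (Q.map fun z => z.1.addPoint z.2) +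
        eLpNorm (f - c) 2 (Q.map Prod.fst)) := by
  have hfc : Measurable (f - c) := hf.sub hc
  have hsplit : (fun z : CountingMeasure U × U => diffOp z.2 c z.1) =
      (fun z => diffOp z.2 f z.1) - fun z => diffOp z.2 (f - c) z.1 := by
    ext z
    simp only [diffOp, Pi.sub_apply]
    ring
  rw [hsplit]
  exact (eLpNorm_sub_le (measurable_diffOp hf).aestronglyMeasurable
    (measurable_diffOp hfc).aestronglyMeasurable (by norm_num)).trans
      (add_le_add le_rfl (eLpNorm_diffOp_le hfc Q))

theorem eLpNorm_sub_integral_le_of_approx {L : Measure (CountingMeasure U)}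
    [IsProbabilityMeasure L] {Q : Measure (CountingMeasure U × U)} (hf : Measurable f)
    (hc : Measurable c)
    (h : eLpNorm (c - fun _ => L[c]) 2 L ≤ eLpNorm (fun z => diffOp z.2 c z.1) 2 Q) :
    eLpNorm (f - fun _ => L[f]) 2 L ≤ eLpNorm (fun z => diffOp z.2 f z.1) 2 Q +
      3 * eLpNorm (f - c) 2 (L + (Q.map (fun z => z.1.addPoint z.2) + Q.map Prod.fst)) := by
  set ν := L + (Q.map (fun z => z.1.addPoint z.2) + Q.map Prod.fst)
  have hL : eLpNorm (f - c) 2 L ≤ eLpNorm (f - c) 2 ν :=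
    eLpNorm_mono_measure _ (Measure.le_add_right le_rfl)
  have hadd : eLpNorm (f - c) 2 (Q.map fun z => z.1.addPoint z.2) ≤ eLpNorm (f - c) 2 ν :=
    eLpNorm_mono_measure _ (Measure.le_add_left (Measure.le_add_right le_rfl))
  have hfst : eLpNorm (f - c) 2 (Q.map Prod.fst) ≤ eLpNorm (f - c) 2 ν :=
    eLpNorm_mono_measure _ (Measure.le_add_left (Measure.le_add_left le_rfl))
  have hcD := h.trans (eLpNorm_diffOp_le_of_approx hf hc)
  refine (eLpNorm_sub_integral_le hf.aestronglyMeasurable hc.aestronglyMeasurable).trans ?_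
  refine (add_le_add hL (hcD.trans (add_le_add le_rfl (add_le_add hadd hfst)))).trans_eq ?_
  ring

end Approximation

namespace IsPoissonProcess

variable {U : Type*} [MeasurableSpace U] {μ : Measure U} {L : Measure (CountingMeasure U)}
  [IsProbabilityMeasure L]

theorem evariance_le_of_comp_restrict (h : IsPoissonProcess id μ L) {S : Set U}
    (hS : MeasurableSet S) (hfin : μ S ≠ ∞) {f : CountingMeasure U → ℝ} (hf : Measurable f)
    {M : ℝ} (hM : ∀ ξ, |f ξ| ≤ M) (hfS : ∀ ξ, f (ξ.restrict hS) = f ξ) :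
    evariance f L ≤ ∫⁻ u in S, ∫⁻ ξ, ‖diffOp u f ξ‖ₑ ^ 2 ∂L ∂μ := by
  have : IsFiniteMeasure (μ.restrict S) := ⟨by simpa using hfin.lt_top⟩
  let Q := L.prod (μ.restrict S)
  let ν := L + (Q.map (fun z => z.1.addPoint z.2) + Q.map Prod.fst)
  have hr := CountingMeasure.measurable_restrict hS
  refine (evariance_le_lintegral_diffOp_iff hf).2
    (ENNReal.le_of_forall_pos_le_add fun ε hε _ => ?_)
  obtain ⟨T, g, hg, hle⟩ := exists_finset_eLpNorm_sub_le
    (CountingMeasure.measurableSpace_eq_comap_eval_measurableSet U)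
    (ν := ν.map (CountingMeasure.restrict hS)) (p := 2) ENNReal.ofNat_ne_top hf
    (MemLp.of_bound hf.aestronglyMeasurable M (.of_forall hM))
    (ε := ε / 3) (by simpa using hε.ne')
  let c : CountingMeasure U → ℝ := fun ξ => g fun W => (ξ : Measure U) (W ∩ S)
  have hc : Measurable c := hg.comp
    (measurable_pi_lambda _ fun W => CountingMeasure.measurable_eval (W.1.2.inter hS))
  have hfc : eLpNorm (f - c) 2 ν ≤ ε / 3 := by
    rw [eLpNorm_map_measure _ hr.aemeasurable] at hle
    · convert hle using 2
      ext ξ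
      simp only [c, Pi.sub_apply, Function.comp_apply, hfS,
        CountingMeasure.restrict_apply hS _ (Subtype.prop _)]
    · exact (hf.sub (hg.comp (measurable_pi_lambda _
        fun W => CountingMeasure.measurable_eval W.1.2))).aestronglyMeasurable
  have hcS := h.evariance_comp_eval_inter_le (W := fun W : T => W.1) (fun W => W.1.2) hS hfin hg
    (c := c) fun _ => rfl
  refine (eLpNorm_sub_integral_le_of_approx hf hc
    ((evariance_le_lintegral_diffOp_iff hc).1 hcS)).trans ?_
  gcongr
  exact (mul_le_mul_right hfc 3).trans_eq
    (ENNReal.mul_div_cancel (by norm_num) (by norm_num))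

theorem lintegral_lintegral_glue (h : IsPoissonProcess id μ L) {S : Set U} (hS : MeasurableSet S)
    {F : CountingMeasure U → ℝ≥0∞} (hF : Measurable F) :
    ∫⁻ ζ, ∫⁻ ξ, F (CountingMeasure.glue hS ξ ζ) ∂L ∂L = ∫⁻ ξ, F ξ ∂L := by
  have hglue := h.measurePreserving_glue hS
  exact (lintegral_prod_symm _ (hF.comp hglue.measurable).aemeasurable).symm.trans
    (hglue.lintegral_comp hF)

theorem lintegral_evariance_glue_le (h : IsPoissonProcess id μ L) {S : Set U}
    (hS : MeasurableSet S) (hfin : μ S ≠ ∞) {f : CountingMeasure U → ℝ} (hf : Measurable f)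
    {M : ℝ} (hM : ∀ ξ, |f ξ| ≤ M) :
    ∫⁻ ζ, evariance (fun ξ => f (CountingMeasure.glue hS ξ ζ)) L ∂L ≤
      ∫⁻ u in S, ∫⁻ ξ, ‖diffOp u f ξ‖ₑ ^ 2 ∂L ∂μ := by
  have : IsFiniteMeasure (μ.restrict S) := ⟨by simpa using hfin.lt_top⟩
  have hglue := h.measurePreserving_glue hS
  have hD : Measurable fun z : CountingMeasure U × U => ‖diffOp z.2 f z.1‖ₑ ^ 2 :=
    (measurable_diffOp hf).enorm.pow_const 2
  have hshuffle : Measurable fun z : (CountingMeasure U × U) × CountingMeasure U =>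
      (CountingMeasure.glue hS z.2 z.1.1, z.1.2) :=
    (hglue.measurable.comp (measurable_snd.prodMk (measurable_fst.comp measurable_fst))).prodMk
      (measurable_snd.comp measurable_fst)
  have hsection (ζ) : evariance (fun ξ => f (CountingMeasure.glue hS ξ ζ)) L ≤
      ∫⁻ u in S, ∫⁻ ξ, ‖diffOp u f (CountingMeasure.glue hS ξ ζ)‖ₑ ^ 2 ∂L ∂μ := by
    refine (h.evariance_le_of_comp_restrict hS hfin
      (hf.comp (hglue.measurable.comp measurable_prodMk_right)) (fun _ => hM _)
      fun ξ => congrArg f (CountingMeasure.glue_restrict_left hS ξ ζ)).trans_eq ?_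
    refine setLIntegral_congr_fun hS fun u hu => ?_
    simp only [diffOp, Function.comp_apply, CountingMeasure.glue_addPoint hS _ _ hu]
  refine (lintegral_mono hsection).trans_eq ?_
  rw [lintegral_lintegral_swap (hD.comp hshuffle).lintegral_prod_right'.aemeasurable]
  exact lintegral_congr fun u => h.lintegral_lintegral_glue hS (hD.comp measurable_prodMk_right)

theorem exists_evariance_integral_glue_le [SigmaFinite μ] (h : IsPoissonProcess id μ L)
    {f : CountingMeasure U → ℝ} (hf : Measurable f) (hfL : MemLp f 2 L) {ε : ℝ≥0∞} (hε : ε ≠ 0) :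
    ∃ (S : Set U) (hS : MeasurableSet S), μ S ≠ ∞ ∧
      evariance (fun ζ => ∫ ξ, f (CountingMeasure.glue hS ξ ζ) ∂L) L ≤ ε ^ 2 := by
  obtain ⟨T, g, hg, hle⟩ := exists_finset_eLpNorm_sub_le
    (CountingMeasure.measurableSpace_eq_comap_eval_subset (monotone_spanningSets μ)
      (measurableSet_spanningSets μ) (iUnion_spanningSets μ)) ENNReal.ofNat_ne_top hf hfL hε
  let c : CountingMeasure U → ℝ := fun ξ => g fun W => (ξ : Measure U) W
  have hc : Measurable c := hg.comp
    (measurable_pi_lambda _ fun W => CountingMeasure.measurable_eval W.1.2.1)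
  choose! m hm using fun W : {W : Set U // MeasurableSet W ∧ ∃ m, W ⊆ spanningSets μ m} => W.2.2
  have hS := measurableSet_spanningSets μ (T.sup m)
  refine ⟨_, hS, (measure_spanningSets_lt_top μ _).ne, ?_⟩
  have hglue := h.measurePreserving_glue hS
  have hcglue (ξ ζ) : c (CountingMeasure.glue hS ξ ζ) = c ξ := by
    simp only [c]
    congr 1
    ext W
    exact CountingMeasure.glue_apply_of_subset hS ξ ζ W.1.2.1
      ((hm W).trans (monotone_spanningSets μ (Finset.le_sup W.2)))
  have hfglue : Measurable fun z : CountingMeasure U × CountingMeasure U =>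
    f (CountingMeasure.glue hS z.1 z.2) := hf.comp hglue.measurable
  calc evariance (fun ζ => ∫ ξ, f (CountingMeasure.glue hS ξ ζ) ∂L) L
      ≤ ∫⁻ ζ, ‖∫ ξ, f (CountingMeasure.glue hS ξ ζ) ∂L - ∫ ξ, c ξ ∂L‖ₑ ^ 2 ∂L :=
        evariance_le_lintegral_enorm_sub_const_sq
          hfglue.stronglyMeasurable.integral_prod_left'.aestronglyMeasurable _
    _ ≤ ∫⁻ ζ, ∫⁻ ξ, ‖f (CountingMeasure.glue hS ξ ζ) - c (CountingMeasure.glue hS ξ ζ)‖ₑ ^ 2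
          ∂L ∂L := by
        simp only [hcglue]
        exact lintegral_mono fun ζ => enorm_integral_sub_integral_sq_le
          (hfglue.comp measurable_prodMk_right).aestronglyMeasurable hc.aestronglyMeasurable
    _ = ∫⁻ ξ, ‖f ξ - c ξ‖ₑ ^ 2 ∂L :=
        h.lintegral_lintegral_glue hS ((hf.sub hc).enorm.pow_const 2)
    _ ≤ ε ^ 2 := by
        rw [← eLpNorm_two_sq_eq_lintegral]
        exact pow_le_pow_left' hle 2

theorem evariance_le [SigmaFinite μ] (h : IsPoissonProcess id μ L) {f : CountingMeasure U → ℝ}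
    (hf : Measurable f) {M : ℝ} (hM : ∀ ξ, |f ξ| ≤ M) :
    evariance f L ≤ ∫⁻ ξ, ∫⁻ u, ‖diffOp u f ξ‖ₑ ^ 2 ∂μ ∂L := by
  have hfL : MemLp f 2 L := MemLp.of_bound hf.aestronglyMeasurable M (.of_forall hM)
  rw [lintegral_lintegral_swap ((measurable_diffOp hf).enorm.pow_const 2).aemeasurable]
  refine ENNReal.le_of_forall_pos_le_add fun ε hε _ => ?_
  have hδ : NNReal.sqrt ε ≠ 0 := by simpa using hε.ne'
  obtain ⟨S, hS, hfin, hle⟩ := h.exists_evariance_integral_glue_le hf hfL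
    (ε := NNReal.sqrt ε) (by exact_mod_cast hδ)
  have hglue := h.measurePreserving_glue hS
  calc evariance f L
      = evariance (fun z => f (CountingMeasure.glue hS z.1 z.2)) (L.prod L) :=
        (evariance_comp_of_measurePreserving hglue hf.aestronglyMeasurable).symm
    _ = ∫⁻ ζ, evariance (fun ξ => f (CountingMeasure.glue hS ξ ζ)) L ∂L +
          evariance (fun ζ => ∫ ξ, f (CountingMeasure.glue hS ξ ζ) ∂L) L :=
        evariance_prod (hf.comp hglue.measurable)
    _ ≤ ∫⁻ u, ∫⁻ ξ, ‖diffOp u f ξ‖ₑ ^ 2 ∂L ∂μ + ε := by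
        gcongr
        · exact (h.lintegral_evariance_glue_le hS hfin hf hM).trans (setLIntegral_le_lintegral _ _)
        · exact hle.trans_eq (by exact_mod_cast NNReal.sq_sqrt ε)

end IsPoissonProcess

section PowerInequalities

theorem rpow_sub_rpow_le_mul_sub {s t q : ℝ} (ht : 0 ≤ t) (hts : t ≤ s) (hq : 1 ≤ q) :
    s ^ q - t ^ q ≤ q * s ^ (q - 1) * (s - t) := by
  obtain rfl | hs := (ht.trans hts).eq_or_lt
  · simp [le_antisymm hts ht]
  have hbern : 1 + q * (t / s - 1) ≤ (t / s) ^ q := by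
    simpa using one_add_mul_self_le_rpow_one_add (s := t / s - 1)
      (by linarith [div_nonneg ht hs.le]) hq
  rw [Real.div_rpow ht hs.le, le_div_iff₀ (Real.rpow_pos_of_pos hs q)] at hbern
  have hsq : s ^ q = s ^ (q - 1) * s := by rw [← Real.rpow_add_one hs.ne', sub_add_cancel]
  have hcancel : t / s * s = t := div_mul_cancel₀ t hs.ne'
  rw [hsq] at hbern ⊢
  linear_combination hbern - q * s ^ (q - 1) * hcancel

theorem enorm_abs_rpow_sub_abs_rpow_le {q : ℝ} (hq : 1 ≤ q) (a b : ℝ) :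
    ‖|a| ^ q - |b| ^ q‖ₑ ≤
      ENNReal.ofReal q * max ‖a‖ₑ ‖b‖ₑ ^ (q - 1) * ‖a - b‖ₑ := by
  wlog hab : |b| ≤ |a| generalizing a b
  · rw [enorm_sub_rev, enorm_sub_rev a, max_comm]
    exact this b a (le_of_not_ge hab)
  have hpow : |b| ^ q ≤ |a| ^ q := Real.rpow_le_rpow (abs_nonneg b) hab (by linarith)
  have hmax : ‖b‖ₑ ≤ ‖a‖ₑ := by
    simpa only [Real.enorm_eq_ofReal_abs] using ENNReal.ofReal_le_ofReal hab
  rw [max_eq_left hmax, Real.enorm_eq_ofReal_abs, Real.enorm_eq_ofReal_abs,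
    Real.enorm_eq_ofReal_abs, ENNReal.ofReal_rpow_of_nonneg (abs_nonneg a) (by linarith),
    ← ENNReal.ofReal_mul (by linarith), ← ENNReal.ofReal_mul (by positivity),
    abs_of_nonneg (sub_nonneg.2 hpow)]
  refine ENNReal.ofReal_le_ofReal ((rpow_sub_rpow_le_mul_sub (abs_nonneg b) hab hq).trans ?_)
  gcongr
  exact abs_sub_abs_le_abs_sub a b

/-- The constant in the chain rule for `x ↦ |x| ^ (p / 2)`. -/
noncomputable def chainConst (p : ℝ) : ℝ≥0 :=
  (p / 2).toNNReal ^ 2 * 2 ^ (p - 2)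

theorem add_rpow_le_two_rpow_mul {s : ℝ} (hs : 0 ≤ s) (x y : ℝ≥0∞) :
    (x + y) ^ s ≤ 2 ^ s * (x ^ s + y ^ s) := by
  wlog hxy : x ≤ y generalizing x y
  · rw [add_comm x, add_comm (x ^ s)]
    exact this y x (le_of_not_ge hxy)
  calc (x + y) ^ s ≤ (2 * y) ^ s := by
        rw [two_mul]
        gcongr
    _ = 2 ^ s * y ^ s := ENNReal.mul_rpow_of_nonneg _ _ hs
    _ ≤ 2 ^ s * (x ^ s + y ^ s) := by gcongr; exact le_add_self

theorem enorm_abs_rpow_half_sub_sq_le {p : ℝ} (hp : 2 ≤ p) (a b : ℝ) :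
    ‖|a| ^ (p / 2) - |b| ^ (p / 2)‖ₑ ^ 2 ≤
      chainConst p * (‖b‖ₑ ^ (p - 2) * ‖a - b‖ₑ ^ 2 + ‖a - b‖ₑ ^ p) := by
  have hmax : max ‖a‖ₑ ‖b‖ₑ ≤ ‖b‖ₑ + ‖a - b‖ₑ := by
    refine max_le ?_ le_self_add
    simpa using enorm_add_le b (a - b)
  have hsq (x : ℝ≥0∞) : (x ^ (p / 2 - 1)) ^ 2 = x ^ (p - 2) := by
    rw [← ENNReal.rpow_mul_natCast]
    congr 1
    push_cast
    ring
  have hd : ‖a - b‖ₑ ^ p = ‖a - b‖ₑ ^ (p - 2) * ‖a - b‖ₑ ^ 2 := by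
    rw [← ENNReal.rpow_two, ← ENNReal.rpow_add_of_nonneg _ _ (by linarith) two_pos.le,
      sub_add_cancel]
  calc ‖|a| ^ (p / 2) - |b| ^ (p / 2)‖ₑ ^ 2
      ≤ (ENNReal.ofReal (p / 2) * (max ‖a‖ₑ ‖b‖ₑ) ^ (p / 2 - 1) * ‖a - b‖ₑ) ^ 2 :=
        pow_le_pow_left' (enorm_abs_rpow_sub_abs_rpow_le (by linarith) a b) 2
    _ = ENNReal.ofReal (p / 2) ^ 2 * (max ‖a‖ₑ ‖b‖ₑ) ^ (p - 2) * ‖a - b‖ₑ ^ 2 := by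
        rw [mul_pow, mul_pow, hsq]
    _ ≤ ENNReal.ofReal (p / 2) ^ 2 * (2 ^ (p - 2) * (‖b‖ₑ ^ (p - 2) + ‖a - b‖ₑ ^ (p - 2))) *
          ‖a - b‖ₑ ^ 2 := by
        gcongr
        exact (ENNReal.rpow_le_rpow hmax (by linarith)).trans
          (add_rpow_le_two_rpow_mul (by linarith) _ _)
    _ = chainConst p * (‖b‖ₑ ^ (p - 2) * ‖a - b‖ₑ ^ 2 + ‖a - b‖ₑ ^ p) := by
        rw [hd, chainConst, ENNReal.coe_mul, ENNReal.coe_pow,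
          ENNReal.coe_rpow_of_nonneg _ (by linarith : 0 ≤ p - 2)]
        simp only [ENNReal.ofReal, ENNReal.coe_ofNat]
        ring

theorem mul_rpow_sub_one {s : ℝ} (hs : 1 ≤ s) (x : ℝ≥0∞) : x * x ^ (s - 1) = x ^ s := by
  nth_rw 1 [← ENNReal.rpow_one x]
  rw [← ENNReal.rpow_add_of_nonneg _ _ one_pos.le (by linarith), add_sub_cancel]

theorem rpow_mul_rpow_sub_le {s p : ℝ} (hs : 1 ≤ s) (hsp : s ≤ p) {R N : ℝ≥0∞} (h : R ≤ N) :
    R ^ s * N ^ (p - s) ≤ R * N ^ (p - 1) := by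
  calc R ^ s * N ^ (p - s) = R * R ^ (s - 1) * N ^ (p - s) := by
        rw [mul_rpow_sub_one hs]
    _ ≤ R * N ^ (s - 1) * N ^ (p - s) := by gcongr
    _ = R * N ^ (p - 1) := by
        rw [mul_assoc, ← ENNReal.rpow_add_of_nonneg _ _ (by linarith) (by linarith)]
        congr 2
        ring

theorem le_mul_of_rpow_le_add {p a : ℝ} (hp : 2 ≤ p) (ha : 1 ≤ a) (hap : a ≤ p) {c : ℝ≥0}
    {R N : ℝ≥0∞} (hN : N ≠ ∞)
    (h : N ^ p ≤ R ^ a * N ^ (p - a) + c * (R ^ (2 : ℝ) * N ^ (p - 2) + R ^ p)) :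
    N ≤ (1 + 2 * c) * R := by
  obtain hNR | hRN := le_total N R
  · exact hNR.trans (le_mul_of_one_le_left' le_self_add)
  obtain rfl | hN0 := eq_or_ne N 0
  · exact zero_le
  have hNp : N ^ (p - 1) ≠ 0 := (ENNReal.rpow_pos (pos_iff_ne_zero.2 hN0) hN).ne'
  have hRp : R ^ p ≤ R * N ^ (p - 1) := by
    simpa using rpow_mul_rpow_sub_le (by linarith) (le_refl p) hRN
  have hsum : N * N ^ (p - 1) ≤ (1 + 2 * c) * R * N ^ (p - 1) := by
    calc N * N ^ (p - 1) = N ^ p := mul_rpow_sub_one (by linarith) N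
      _ ≤ R * N ^ (p - 1) + c * (R * N ^ (p - 1) + R * N ^ (p - 1)) := by
          refine h.trans (add_le_add (rpow_mul_rpow_sub_le ha hap hRN) ?_)
          exact mul_le_mul_right (add_le_add (rpow_mul_rpow_sub_le one_le_two hp hRN) hRp) _
      _ = (1 + 2 * c) * R * N ^ (p - 1) := by ring
  exact (ENNReal.mul_le_mul_iff_left hNp (ENNReal.rpow_ne_top_of_nonneg (by linarith) hN)).1 hsum

end PowerInequalities

section Moments

variable {X : Type*} [MeasurableSpace X] {ν : Measure X}

theorem eLpNorm_ofReal_rpow {ε : Type*} [ENorm ε] (ν : Measure X) (f : X → ε) {s : ℝ}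
    (hs : 0 < s) : eLpNorm f (ENNReal.ofReal s) ν ^ s = ∫⁻ x, ‖f x‖ₑ ^ s ∂ν := by
  rw [eLpNorm_eq_lintegral_rpow_enorm_toReal (by simpa using hs) ENNReal.ofReal_ne_top,
    ENNReal.toReal_ofReal hs.le, ← ENNReal.rpow_mul, one_div_mul_cancel hs.ne', ENNReal.rpow_one]

theorem eLpNorm_one_le_enorm_integral_add [IsProbabilityMeasure ν] {f : X → ℝ}
    (hf : AEStronglyMeasurable f ν) {M : ℝ≥0∞} (hM : evariance f ν ≤ M ^ 2) :
    eLpNorm f 1 ν ≤ ‖ν[f]‖ₑ + M := by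
  have hconst : AEStronglyMeasurable (fun _ => ν[f]) ν := aestronglyMeasurable_const
  have hdev : eLpNorm (f - fun _ => ν[f]) 2 ν ≤ M := by
    rw [← ENNReal.pow_le_pow_left_iff two_ne_zero, eLpNorm_two_sq_eq_lintegral]
    exact hM
  have hdev_one : eLpNorm (f - fun _ => ν[f]) 1 ν ≤ M :=
    (eLpNorm_le_eLpNorm_of_exponent_le one_le_two (hf.sub hconst)).trans hdev
  have hconst_one : eLpNorm (fun _ => ν[f]) 1 ν = ‖ν[f]‖ₑ := by
    simp [eLpNorm_one_eq_lintegral_enorm]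
  have htriangle := eLpNorm_add_le hconst (hf.sub hconst) le_rfl
  rw [add_sub_cancel, hconst_one] at htriangle
  exact htriangle.trans (by gcongr)

theorem lintegral_rpow_half_sq_le {p : ℝ} (hp : 2 ≤ p) {w : X → ℝ≥0∞} (hw : AEMeasurable w ν) :
    (∫⁻ x, w x ^ (p / 2) ∂ν) ^ 2 ≤
      (∫⁻ x, w x ∂ν) ^ (p / (p - 1)) * (∫⁻ x, w x ^ p ∂ν) ^ ((p - 2) / (p - 1)) := by
  have hp1 : 0 < p - 1 := by linarith
  have hα : 0 ≤ p / (p - 1) / 2 := by positivity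
  have hβ : 0 ≤ (p - 2) / (p - 1) / 2 := by
    have : 0 ≤ p - 2 := by linarith
    positivity
  have hholder := ENNReal.lintegral_mul_norm_pow_le hw (hw.pow_const p) hα hβ
    (by field_simp; ring)
  have hsplit (x) : w x ^ (p / (p - 1) / 2) * (w x ^ p) ^ ((p - 2) / (p - 1) / 2) =
      w x ^ (p / 2) := by
    rw [← ENNReal.rpow_mul, ← ENNReal.rpow_add_of_nonneg _ _ hα (by positivity)]
    congr 1
    field_simp
    ring
  simp only [hsplit] at hholder
  refine (pow_le_pow_left' hholder 2).trans_eq ?_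
  rw [mul_pow, ← ENNReal.rpow_mul_natCast, ← ENNReal.rpow_mul_natCast]
  norm_num

theorem lintegral_enorm_rpow_le_evariance_add [IsProbabilityMeasure ν] {p : ℝ} {f : X → ℝ}
    (hf : Measurable f) (hp : 0 ≤ p) :
    ∫⁻ x, ‖f x‖ₑ ^ p ∂ν ≤ evariance (fun x => |f x| ^ (p / 2)) ν +
      (∫⁻ x, ‖f x‖ₑ ^ (p / 2) ∂ν) ^ 2 := by
  have henorm (x) : ‖|f x| ^ (p / 2)‖ₑ = ‖f x‖ₑ ^ (p / 2) := by
    rw [Real.enorm_rpow_of_nonneg (abs_nonneg _) (by linarith), Real.enorm_abs]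
  have hsq (x) : ‖f x‖ₑ ^ p = ‖|f x| ^ (p / 2) - 0‖ₑ ^ 2 := by
    rw [sub_zero, henorm, ← ENNReal.rpow_mul_natCast]
    norm_num
  have hg : Measurable fun x => |f x| ^ (p / 2) := hf.abs.pow_const _
  simp only [hsq]
  rw [lintegral_enorm_sub_const_sq hg.aestronglyMeasurable, sub_zero]
  simp only [← henorm]
  gcongr
  exact enorm_integral_le_lintegral_enorm _

theorem lintegral_rpow_sub_two_mul_sq_le {p : ℝ} (hp : 2 ≤ p) {a b : X → ℝ≥0∞}
    (ha : AEMeasurable a ν) (hb : AEMeasurable b ν) :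
    ∫⁻ x, a x ^ (p - 2) * b x ^ 2 ∂ν ≤
      (∫⁻ x, a x ^ p ∂ν) ^ ((p - 2) / p) * (∫⁻ x, b x ^ p ∂ν) ^ (2 / p) := by
  have hp0 : 0 < p := by linarith
  have hexp : 0 ≤ (p - 2) / p := div_nonneg (by linarith) hp0.le
  refine le_of_eq_of_le (lintegral_congr fun x => ?_)
    (ENNReal.lintegral_mul_norm_pow_le (ha.pow_const p) (hb.pow_const p) hexp
      (by positivity : 0 ≤ 2 / p) (by field_simp; ring))
  rw [← ENNReal.rpow_mul, ← ENNReal.rpow_mul, mul_div_cancel₀ _ hp0.ne',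
    mul_div_cancel₀ _ hp0.ne', ENNReal.rpow_two]

end Moments

section Control

variable {X U : Type*} [MeasurableSpace X] [MeasurableSpace U]

/-- The number `M` bounds the random function `G` strongly enough for the `L^p` Poincaré
inequality: `M ^ p` bounds the `p`-th moment of `G`, and for every weight `w ≥ 0` the integral
of `w ^ (p - 2) |G| ^ 2` is at most `‖w‖_p ^ (p - 2) M ^ 2`. Both the norm of
`L^p_ω L^2_u ∩ L^p_ω L^p_u` and that of `Σ_u^{2, p} L^p_ω` are such bounds. -/
structure IsControl (p : ℝ) (L : Measure X) (μ : Measure U) (G : X → U → ℝ) (M : ℝ≥0∞) :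
    Prop where
  weighted : ∀ w : X → ℝ≥0∞, Measurable w →
    ∫⁻ x, w x ^ (p - 2) * ∫⁻ u, ‖G x u‖ₑ ^ 2 ∂μ ∂L ≤ (∫⁻ x, w x ^ p ∂L) ^ ((p - 2) / p) * M ^ 2
  power : ∫⁻ x, ∫⁻ u, ‖G x u‖ₑ ^ p ∂μ ∂L ≤ M ^ p

namespace IsControl

variable {p : ℝ} {L : Measure X} {μ : Measure U} {G G' : X → U → ℝ} {M : ℝ≥0∞}

theorem lintegral_sq_le [IsProbabilityMeasure L] (h : IsControl p L μ G M) :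
    ∫⁻ x, ∫⁻ u, ‖G x u‖ₑ ^ 2 ∂μ ∂L ≤ M ^ 2 := by
  simpa using h.weighted (fun _ => 1) measurable_const

theorem mono (h : IsControl p L μ G M) (hp : 0 ≤ p) (hG : ∀ x u, |G' x u| ≤ |G x u|) :
    IsControl p L μ G' M where
  weighted w hw := by
    refine le_trans ?_ (h.weighted w hw)
    gcongr with x u
    simpa only [Real.enorm_eq_ofReal_abs] using ENNReal.ofReal_le_ofReal (hG x u)
  power := by
    refine le_trans ?_ h.power
    gcongr with x u
    simpa only [Real.enorm_eq_ofReal_abs] using ENNReal.ofReal_le_ofReal (hG x u)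

theorem map [SFinite μ] {Ω : Type*} [MeasurableSpace Ω] {P : Measure Ω} {η : Ω → X}
    (hη : Measurable η) (hG : Measurable (Function.uncurry G))
    (h : IsControl p P μ (fun ω => G (η ω)) M) : IsControl p (P.map η) μ G M where
  weighted w hw := by
    have hsq : Measurable fun x => ∫⁻ u, ‖G x u‖ₑ ^ 2 ∂μ :=
      (hG.enorm.pow_const 2).lintegral_prod_right'
    have hweighted : Measurable fun x => w x ^ (p - 2) * ∫⁻ u, ‖G x u‖ₑ ^ 2 ∂μ :=
      (hw.pow_const _).mul hsq
    rw [lintegral_map hweighted hη, lintegral_map (hw.pow_const p) hη]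
    exact h.weighted (w ∘ η) (hw.comp hη)
  power := by
    have hpow : Measurable fun x => ∫⁻ u, ‖G x u‖ₑ ^ p ∂μ :=
      (hG.enorm.pow_const p).lintegral_prod_right'
    rw [lintegral_map hpow hη]
    exact h.power

end IsControl

end Control

theorem lintegral_enorm_diffOp_abs_rpow_half_sq_le {U : Type*} [MeasurableSpace U]
    {μ : Measure U} {p : ℝ} (hp : 2 ≤ p) {f : CountingMeasure U → ℝ} (hf : Measurable f)
    (ξ : CountingMeasure U) :
    ∫⁻ u, ‖diffOp u (fun ξ => |f ξ| ^ (p / 2)) ξ‖ₑ ^ 2 ∂μ ≤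
      chainConst p * (‖f ξ‖ₑ ^ (p - 2) * ∫⁻ u, ‖diffOp u f ξ‖ₑ ^ 2 ∂μ +
        ∫⁻ u, ‖diffOp u f ξ‖ₑ ^ p ∂μ) := by
  have hD : Measurable fun u => diffOp u f ξ := (measurable_diffOp hf).comp measurable_prodMk_left
  rw [← lintegral_const_mul _ (hD.enorm.pow_const 2),
    ← lintegral_add_left ((hD.enorm.pow_const 2).const_mul _),
    ← lintegral_const_mul' _ _ ENNReal.coe_ne_top]
  exact lintegral_mono fun u => enorm_abs_rpow_half_sub_sq_le hp _ _

namespace IsPoissonProcess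

variable {U : Type*} [MeasurableSpace U] {μ : Measure U} [SigmaFinite μ]
  {L : Measure (CountingMeasure U)} [IsProbabilityMeasure L] {f : CountingMeasure U → ℝ}
  {p : ℝ} {M : ℝ≥0∞}

theorem evariance_abs_rpow_half_le_of_isControl (h : IsPoissonProcess id μ L) (hp : 2 ≤ p)
    (hf : Measurable f) {B : ℝ} (hB : ∀ ξ, |f ξ| ≤ B)
    (hM : IsControl p L μ (fun ξ u => diffOp u f ξ) M) :
    evariance (fun ξ => |f ξ| ^ (p / 2)) L ≤
      chainConst p * ((∫⁻ ξ, ‖f ξ‖ₑ ^ p ∂L) ^ ((p - 2) / p) * M ^ 2 + M ^ p) := by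
  have hDsq : Measurable fun ξ => ∫⁻ u, ‖diffOp u f ξ‖ₑ ^ 2 ∂μ :=
    ((measurable_diffOp hf).enorm.pow_const 2).lintegral_prod_right'
  have hweighted : Measurable fun ξ => ‖f ξ‖ₑ ^ (p - 2) * ∫⁻ u, ‖diffOp u f ξ‖ₑ ^ 2 ∂μ :=
    (hf.enorm.pow_const _).mul hDsq
  have hgB (ξ) : |(|f ξ| ^ (p / 2))| ≤ B ^ (p / 2) := by
    rw [abs_of_nonneg (by positivity)]
    exact Real.rpow_le_rpow (abs_nonneg _) (hB ξ) (by linarith)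
  refine (h.evariance_le (hf.abs.pow_const _) hgB).trans ?_
  refine (lintegral_mono (lintegral_enorm_diffOp_abs_rpow_half_sq_le hp hf)).trans ?_
  rw [lintegral_const_mul' _ _ ENNReal.coe_ne_top, lintegral_add_left hweighted]
  gcongr
  · exact hM.weighted _ hf.enorm
  · exact hM.power

theorem eLpNorm_le_of_isControl_of_bounded (h : IsPoissonProcess id μ L) (hp : 2 ≤ p)
    (hf : Measurable f) {B : ℝ} (hB : ∀ ξ, |f ξ| ≤ B)
    (hM : IsControl p L μ (fun ξ u => diffOp u f ξ) M) :
    eLpNorm f (ENNReal.ofReal p) L ≤ (1 + 2 * chainConst p : ℝ≥0) * (‖L[f]‖ₑ + M) := by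
  have hp0 : 0 < p := by linarith
  have hp1 : 0 < p - 1 := by linarith
  set N := eLpNorm f (ENNReal.ofReal p) L
  have hN : ∫⁻ ξ, ‖f ξ‖ₑ ^ p ∂L = N ^ p := (eLpNorm_ofReal_rpow L f hp0).symm
  have hNfin : N ≠ ∞ := (MemLp.of_bound hf.aestronglyMeasurable B (.of_forall hB)).eLpNorm_ne_top
  have hmean : ∫⁻ ξ, ‖f ξ‖ₑ ∂L ≤ ‖L[f]‖ₑ + M := by
    rw [← eLpNorm_one_eq_lintegral_enorm]
    exact eLpNorm_one_le_enorm_integral_add hf.aestronglyMeasurable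
      ((h.evariance_le hf hB).trans hM.lintegral_sq_le)
  have hinterp : (∫⁻ ξ, ‖f ξ‖ₑ ^ (p / 2) ∂L) ^ 2 ≤
      (‖L[f]‖ₑ + M) ^ (p / (p - 1)) * N ^ (p - p / (p - 1)) := by
    refine (lintegral_rpow_half_sq_le hp hf.enorm.aemeasurable).trans ?_
    rw [hN, ← ENNReal.rpow_mul, show p * ((p - 2) / (p - 1)) = p - p / (p - 1) by field_simp; ring]
    gcongr
  have hvar : evariance (fun ξ => |f ξ| ^ (p / 2)) L ≤ chainConst p *
      ((‖L[f]‖ₑ + M) ^ (2 : ℝ) * N ^ (p - 2) + (‖L[f]‖ₑ + M) ^ p) := by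
    refine (h.evariance_abs_rpow_half_le_of_isControl hp hf hB hM).trans ?_
    rw [hN, ← ENNReal.rpow_mul, mul_div_cancel₀ _ hp0.ne', mul_comm (N ^ _), ENNReal.rpow_two]
    gcongr <;> exact le_add_self
  refine le_mul_of_rpow_le_add hp (a := p / (p - 1)) ?_ ?_ hNfin ?_
  · rw [le_div_iff₀ hp1]
    linarith
  · exact div_le_self hp0.le (by linarith)
  · rw [← hN]
    refine (lintegral_enorm_rpow_le_evariance_add hf hp0.le).trans ?_
    rw [add_comm]
    exact add_le_add hinterp hvar

end IsPoissonProcess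

section MixedNorms

variable {X U : Type*} [MeasurableSpace X] [MeasurableSpace U] {p : ℝ} {L : Measure X}
  {μ : Measure U} {G : X → U → ℝ}

theorem measurable_eLpNorm [SFinite μ] (hG : Measurable (Function.uncurry G)) {q : ℝ≥0∞}
    (hq0 : q ≠ 0) (hq : q ≠ ∞) : Measurable fun x => eLpNorm (G x) q μ := by
  simp_rw [eLpNorm_eq_lintegral_rpow_enorm_toReal hq0 hq]
  exact (hG.enorm.pow_const _).lintegral_prod_right'.pow_const _

theorem mixedNorm_self_rpow (hp : 0 < p) (L : Measure X) (μ : Measure U) (G : X → U → ℝ) :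
    mixedNorm p p L μ G ^ p = ∫⁻ x, ∫⁻ u, ‖G x u‖ₑ ^ p ∂μ ∂L := by
  rw [mixedNorm, eLpNorm_ofReal_rpow _ _ hp]
  exact lintegral_congr fun x => eLpNorm_ofReal_rpow μ (G x) hp

theorem mixedNorm_le_sigmaNorm {S : Finset ℝ} {q : ℝ} (hq : q ∈ S) :
    mixedNorm q p μ L (fun u x => G x u) ≤ sigmaNorm S p L μ G :=
  Finset.single_le_sum (f := fun q => mixedNorm q p μ L fun u x => G x u)
    (fun _ _ => zero_le) hq

theorem isControl_interNorm [SFinite μ] (hp : 2 ≤ p) (hG : Measurable (Function.uncurry G)) :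
    IsControl p L μ G (interNorm p L μ G) where
  weighted w hw := by
    have hp0 : 0 < p := by linarith
    have hmixed : (∫⁻ x, eLpNorm (G x) 2 μ ^ p ∂L) ^ (2 / p) = mixedNorm p 2 L μ G ^ 2 := by
      have hpow := eLpNorm_ofReal_rpow L (fun x => eLpNorm (G x) 2 μ) hp0
      simp only [enorm_eq_self] at hpow
      rw [← hpow, ← ENNReal.rpow_mul, mul_div_cancel₀ _ hp0.ne', ENNReal.rpow_two, mixedNorm,
        ENNReal.ofReal_ofNat]
    simp_rw [← eLpNorm_two_sq_eq_lintegral]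
    refine (lintegral_rpow_sub_two_mul_sq_le hp hw.aemeasurable
      (measurable_eLpNorm hG two_ne_zero ENNReal.ofNat_ne_top).aemeasurable).trans ?_
    rw [hmixed]
    gcongr
    exact le_max_left _ _
  power := by
    rw [← mixedNorm_self_rpow (by linarith)]
    gcongr
    exact le_max_right _ _

theorem isControl_sigmaNorm [SFinite L] [SFinite μ] (hp : 2 ≤ p)
    (hG : Measurable (Function.uncurry G)) : IsControl p L μ G (sigmaNorm {2, p} p L μ G) where
  weighted w hw := by
    have hp0 : 0 < p := by linarith
    have hx (x) : Measurable fun u => ‖G x u‖ₑ ^ 2 :=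
      (hG.comp measurable_prodMk_left).enorm.pow_const 2
    have hweighted : Measurable fun z : X × U => w z.1 ^ (p - 2) * ‖G z.1 z.2‖ₑ ^ 2 :=
      ((hw.comp measurable_fst).pow_const _).mul (hG.enorm.pow_const 2)
    have hnorm : Measurable fun u => eLpNorm (fun x => G x u) (ENNReal.ofReal p) L :=
      measurable_eLpNorm (G := fun u x => G x u) (hG.comp measurable_swap) (by simpa using hp0)
        ENNReal.ofReal_ne_top
    have hu (u) : Measurable fun x => ‖G x u‖ₑ :=
      (hG.comp measurable_prodMk_right).enorm
    have hholder (u) : ∫⁻ x, w x ^ (p - 2) * ‖G x u‖ₑ ^ 2 ∂L ≤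
        (∫⁻ x, w x ^ p ∂L) ^ ((p - 2) / p) *
          eLpNorm (fun x => G x u) (ENNReal.ofReal p) L ^ 2 := by
      refine (lintegral_rpow_sub_two_mul_sq_le hp hw.aemeasurable
        (hu u).aemeasurable).trans_eq ?_
      rw [← eLpNorm_ofReal_rpow L (fun x => G x u) hp0, ← ENNReal.rpow_mul,
        mul_div_cancel₀ _ hp0.ne', ENNReal.rpow_two]
    simp_rw [← lintegral_const_mul _ (hx _)]
    rw [lintegral_lintegral_swap hweighted.aemeasurable]
    refine (lintegral_mono hholder).trans ?_
    rw [lintegral_const_mul _ (hnorm.pow_const 2)]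
    gcongr
    refine le_of_eq_of_le ?_ (pow_le_pow_left' (mixedNorm_le_sigmaNorm (q := 2) (by simp)) 2)
    rw [mixedNorm, ENNReal.ofReal_ofNat, eLpNorm_two_sq_eq_lintegral]
    simp only [enorm_eq_self]
  power := by
    have hp0 : 0 < p := by linarith
    rw [lintegral_lintegral_swap (hG.enorm.pow_const p).aemeasurable,
      ← mixedNorm_self_rpow hp0 μ L fun u x => G x u]
    gcongr
    exact mixedNorm_le_sigmaNorm (by simp)

end MixedNorms

section Truncation

theorem abs_clamp_sub_clamp_le (n a b : ℝ) :
    |max (-n) (min a n) - max (-n) (min b n)| ≤ |a - b| := by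
  refine (abs_max_sub_max_le_max _ _ _ _).trans ?_
  refine max_le (by simp) ((abs_min_sub_min_le_max _ _ _ _).trans ?_)
  simp

theorem abs_clamp_le {n : ℝ} (hn : 0 ≤ n) (a : ℝ) : |max (-n) (min a n)| ≤ n :=
  abs_le.2 ⟨le_max_left _ _, max_le (by linarith) (min_le_right _ _)⟩

theorem abs_clamp_le_abs {n : ℝ} (hn : 0 ≤ n) (a : ℝ) : |max (-n) (min a n)| ≤ |a| := by
  simpa [hn] using abs_clamp_sub_clamp_le n a 0

theorem tendsto_clamp (a : ℝ) :
    Filter.Tendsto (fun n : ℕ => max (-(n : ℝ)) (min a n)) Filter.atTop (nhds a) := by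
  refine tendsto_const_nhds.congr' ?_
  filter_upwards [Filter.eventually_ge_atTop ⌈|a|⌉₊] with n hn
  have h := abs_le.1 (Nat.ceil_le.1 hn)
  rw [min_eq_left h.2, max_eq_right h.1]

end Truncation

namespace IsPoissonProcess

variable {U : Type*} [MeasurableSpace U] {μ : Measure U} [SigmaFinite μ]
  {f : CountingMeasure U → ℝ} {p : ℝ} {M : ℝ≥0∞}

theorem eLpNorm_le_of_isControl {L : Measure (CountingMeasure U)} [IsProbabilityMeasure L]
    (h : IsPoissonProcess id μ L) (hp : 2 ≤ p) (hf : Measurable f) (hfi : Integrable f L)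
    (hM : IsControl p L μ (fun ξ u => diffOp u f ξ) M) :
    eLpNorm f (ENNReal.ofReal p) L ≤ (1 + 2 * chainConst p : ℝ≥0) * (‖L[f]‖ₑ + M) := by
  let F (n : ℕ) (ξ : CountingMeasure U) : ℝ := max (-(n : ℝ)) (min (f ξ) n)
  have hF (n) : Measurable (F n) := measurable_const.max (hf.min measurable_const)
  have hbound (n) : eLpNorm (F n) (ENNReal.ofReal p) L ≤
      (1 + 2 * chainConst p : ℝ≥0) * (‖L[F n]‖ₑ + M) :=
    h.eLpNorm_le_of_isControl_of_bounded hp (hF n) (fun _ => abs_clamp_le n.cast_nonneg _)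
      (hM.mono (by linarith) fun _ _ => abs_clamp_sub_clamp_le _ _ _)
  have hmean : Filter.Tendsto (fun n => L[F n]) Filter.atTop (nhds L[f]) :=
    tendsto_integral_of_dominated_convergence (fun ξ => |f ξ|)
      (fun n => (hF n).aestronglyMeasurable) hfi.abs
      (fun n => .of_forall fun _ => abs_clamp_le_abs n.cast_nonneg _)
      (.of_forall fun _ => tendsto_clamp _)
  have hlim : Filter.Tendsto (fun n => (1 + 2 * chainConst p : ℝ≥0) * (‖L[F n]‖ₑ + M))
      Filter.atTop (nhds ((1 + 2 * chainConst p : ℝ≥0) * (‖L[f]‖ₑ + M))) :=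
    ENNReal.Tendsto.const_mul (hmean.enorm.add tendsto_const_nhds) (.inr ENNReal.coe_ne_top)
  refine (Lp.eLpNorm_lim_le_liminf_eLpNorm (fun n => (hF n).aestronglyMeasurable) f
    (.of_forall fun _ => tendsto_clamp _)).trans ?_
  rw [← hlim.liminf_eq]
  exact Filter.liminf_le_liminf (.of_forall hbound)

theorem eLpNorm_comp_le_of_isControl {Ω : Type*} [MeasurableSpace Ω] {P : Measure Ω}
    [IsProbabilityMeasure P] {η : Ω → CountingMeasure U} (h : IsPoissonProcess η μ P)
    (hp : 2 ≤ p) (hf : Measurable f) (hfi : Integrable (fun ω => f (η ω)) P)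
    (hM : IsControl p P μ (fun ω u => diffOp u f (η ω)) M) :
    eLpNorm (fun ω => f (η ω)) (ENNReal.ofReal p) P ≤
      (1 + 2 * chainConst p : ℝ≥0) * (ENNReal.ofReal |∫ ω, f (η ω) ∂P| + M) := by
  have hη : AEMeasurable η P := h.measurable.aemeasurable
  have := Measure.isProbabilityMeasure_map (μ := P) hη
  have hlaw := h.isPoissonProcess_id_map.eLpNorm_le_of_isControl hp hf
    ((integrable_map_measure hf.aestronglyMeasurable hη).2 hfi)
    (hM.map h.measurable (measurable_diffOp hf))
  rwa [eLpNorm_map_measure hf.aestronglyMeasurable hη, integral_map hη hf.aestronglyMeasurable,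
    Real.enorm_eq_ofReal_abs] at hlaw

end IsPoissonProcess

theorem proposition3p7 (p : ℝ) (hp : 2 ≤ p) :
    ∃ C : ℝ≥0, ∀ (Ω : Type*) [MeasurableSpace Ω] (P : Measure Ω) [IsProbabilityMeasure P]
      (U : Type*) [MeasurableSpace U] (μ : Measure U) [SigmaFinite μ]
      (η : Ω → CountingMeasure U), IsPoissonProcess η μ P →
      ∀ f : CountingMeasure U → ℝ, Measurable f → Integrable (fun ω => f (η ω)) P →
        eLpNorm (fun ω => f (η ω)) (ENNReal.ofReal p) P ≤
            C * (ENNReal.ofReal |∫ ω, f (η ω) ∂P| +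
              interNorm p P μ (fun ω u => diffOp u f (η ω))) ∧
        eLpNorm (fun ω => f (η ω)) (ENNReal.ofReal p) P ≤
            C * (ENNReal.ofReal |∫ ω, f (η ω) ∂P| +
              sigmaNorm {2, p} p P μ (fun ω u => diffOp u f (η ω))) := by
  refine ⟨1 + 2 * chainConst p, fun Ω _ P _ U _ μ _ η h f hf hfi => ?_⟩
  have hD : Measurable fun z : Ω × U => diffOp z.2 f (η z.1) :=
    (measurable_diffOp hf).comp (h.measurable.prodMap measurable_id)
  exact ⟨h.eLpNorm_comp_le_of_isControl hp hf hfi (isControl_interNorm hp hD),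
    h.eLpNorm_comp_le_of_isControl hp hf hfi (isControl_sigmaNorm hp hD)⟩
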